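/- For every integer $d>1$ there is a constant $C>0$, depending only on $d$, with the following property. Let $k$ be a number field of degree $d$ with ring of integers $\mathfrak{o}$ and discriminant $\Delta$. Let $\Sigma$ be the set of embeddings $\sigma:k\hookrightarrow\mathbb{C}$, with $\bar\sigma$ denoting the complex conjugate of $\sigma$. Let $K\subset\mathbb{C}$ be the compositum of the fields $\sigma(k)$ for $\sigma\in\Sigma$, and let $G=\mathrm{Gal}(K/\mathbb{Q})$, which acts on $\Sigma$ by composition. Identify $k\otimes_{\mathbb{Q}}\mathbb{R}$ with the real vector space of all $(z_\sigma)\in\mathbb{C}^\Sigma$ such that $z_{\bar\sigma}=\overline{z_\sigma}$ for all $\sigma\in\Sigma$, and embed $k$ in it by $x\mapsto(\sigma(x))_{\sigma\in\Sigma}$. Let $(B_\sigma)_{\sigma\in\Sigma}$ be positive real numbers such that $B_{\bar\sigma}=B_\sigma$ for all $\sigma\in\Sigma$, and put $$\mathcal{B}=\left\{(z_\sigma)\in\mathbb{C}^\Sigma:\ z_{\bar\sigma}=\overline{z_\sigma}\ \text{and}\ |z_\sigma|\le B_\sigma\ \text{for all}\ \sigma\in\Sigma\right\}.$$ Let $\mathfrak{n}\subset\mathfrak{o}$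 be a nonzero ideal, regarded as a lattice in $k\otimes_{\mathbb{Q}}\mathbb{R}$, and let $m$ be the maximal number of linearly independent (over $\mathbb{R}$) vectors contained in $\mathfrak{n}\cap\mathcal{B}$. If $m<d$, then the set $\mathfrak{n}\cap\mathcal{B}$ is finite and $$|\mathfrak{n}\cap\mathcal{B}|\le C\,|\Delta|^{\min\left(\frac12,\frac{m}{2d-2m}\right)}.$$ Moreover, if $m<d$ and $G$ is $2$-homogeneous, that is, if $G$ acts transitively on the $2$-element subsets of $\Sigma$, then $$|\mathfrak{n}\cap\mathcal{B}|\le C\,|\Delta|^{\frac{m}{2d-2}}.$$ -/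

import Mathlib

open scoped ComplexConjugate

noncomputable section

namespace IdealBox

variable (k : Type*) [Field k]

/-- The Minkowski box `{(z_σ) : z_{σ̄} = conj z_σ and |z_σ| ≤ B_σ for all σ}` in `ℂ^Σ`, where
`Σ` is the set of embeddings `k → ℂ`. The real vector space cut out by the first condition is
the usual model of `k ⊗_ℚ ℝ`. -/
def minkowskiBox (B : (k →+* ℂ) → ℝ) : Set ((k →+* ℂ) → ℂ) :=
  {z | ∀ σ : k →+* ℂ,
    z (NumberField.ComplexEmbedding.conjugate σ) = conj (z σ) ∧ ‖z σ‖ ≤ B σ}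

/-- An ideal of the ring of integers, embedded in `ℂ^Σ` by `x ↦ (σ(x))_σ`. -/
def idealLattice (𝔫 : Ideal (NumberField.RingOfIntegers k)) : Set ((k →+* ℂ) → ℂ) :=
  (fun x : NumberField.RingOfIntegers k => NumberField.canonicalEmbedding k (x : k)) ''
    (𝔫 : Set (NumberField.RingOfIntegers k))

variable [NumberField k]

/-- The compositum (in `ℂ`) of all the conjugate fields `σ(k)`. -/
abbrev galoisClosure : IntermediateField ℚ ℂ :=
  IntermediateField.normalClosure ℚ k ℂ

/-- The Galois group over `ℚ` of the compositum of all the fields `σ(k)`. -/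
abbrev galoisGroup : Type :=
  galoisClosure k ≃ₐ[ℚ] galoisClosure k

variable {k}

/-- An embedding `σ : k → ℂ`, with its codomain restricted to the compositum. -/
def toClosure (σ : k →+* ℂ) : k →+* galoisClosure k :=
  ((normalClosure.algHomEquiv ℚ k ℂ).symm σ.toRatAlgHom).toRingHom

theorem coe_toClosure (σ : k →+* ℂ) (x : k) : (toClosure σ x : ℂ) = σ x := rfl

/-- The Galois group acts on the embeddings of `k` by composition: `(g • σ)(x) = g(σ(x))`. -/
instance embeddingAction : MulAction (galoisGroup k) (k →+* ℂ) where
  smul g σ := ((galoisClosure k).val : galoisClosure k →+* ℂ).comp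
    ((g : galoisClosure k →+* galoisClosure k).comp (toClosure σ))
  one_smul _ := rfl
  mul_smul _ _ _ := rfl

theorem smul_apply (g : galoisGroup k) (σ : k →+* ℂ) (x : k) :
    (g • σ) x = (g (toClosure σ x) : ℂ) := rfl

variable (k)

open Classical in
/-- The Galois group acts transitively on the two-element subsets of the set of embeddings. -/
def IsTwoHomogeneous : Prop :=
  MulAction.IsPretransitive (galoisGroup k) (Set.powersetCard (k →+* ℂ) 2)

end IdealBox

end

/-!
Write `X` for the number of elements of `𝔫` in the box, `d` for the degree of `k`, and `T` for the
product of all `B σ`. Two estimates are played off against each other.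

* Archimedean and arithmetic bounds for a minor. The elements of `𝔫` in the box generate a lattice
  of rank `m`. Among `m`-tuples from the box choose one spanning a sublattice of maximal index; by
  Cramer's rule all of the box lies in the parallelepiped with coefficients in `[-1, 1]`, so the
  index is at least `X / 3 ^ m`. Hence a basis `z` of the lattice has all its minors
  `det (h i (z j))` bounded by `m! 3 ^ m / X * ∏ B (h i)` (`exists_family_of_idealBox`). For
  distinct embeddings `f i` the minor `det (f i (z j))` is an algebraic integer of the compositum,
  and it lies in the product of the ideals `f i (𝔫)` and of the congruence ideals
  `diffIdeal (f i) (f j)`, `j < i`, generated by the differences `f i a - f j a`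
  (`det_mem_prod_diffIdeal`). This is proved one prime `𝔓` at a time: modulo a power of `𝔓`, all
  embeddings with the same reduction are evaluations of one family of polynomials, so Newton
  interpolation exhibits the differences as factors. Taking norms from the compositum compares
  both bounds (`log_absNorm_add_sum_logDiff_le`).

* Blichfeldt's principle for half of the box gives
  `T ≤ 2 ^ d * X * N(𝔫) * √|Δ|` (`prod_le_ncard_idealBox`).

Eliminating `T` and `N(𝔫)` leaves `X ^ (d - m) ≪ |Δ| ^ (m / 2) / D`, where `D` is the normalized
norm of the congruence ideals of the chosen `m` embeddings (`ncard_idealBox_le`). For all `d`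
embeddings the product of the congruence ideals is exactly the square root of the discriminant
(`prod_diffIdeal_eq_span_det`), so that the symmetric matrix `logDiff σ τ` of their logarithmic
norms has total sum `log |Δ|`. Three lower bounds for `D` give the three exponents: `D ≥ 1`; the
equality of the row sums of `logDiff`, which comes from the transitivity of the Galois group
(`le_sum_sum_logDiff`); and, for a `2`-homogeneous Galois group, the equality of all off-diagonal
entries (`IsTwoHomogeneous.sum_sum_logDiff_eq`).
-/

/-! ### Congruences between ring homomorphisms and divisibility of minors -/

open Polynomial in
/-- Newton interpolation with remainder, at the nodes `a l`, `l ∈ s`, in increasing order. -/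
theorem Polynomial.exists_newton_expansion {R ι : Type*} [CommRing R] [LinearOrder ι]
    (a : ι → R) (s : Finset ι) (g : R[X]) :
    ∃ (N : ι → R) (r : R[X]),
      g = ∑ l ∈ s, C (N l) * ∏ j ∈ s with j < l, (X - C (a j)) + r * ∏ j ∈ s, (X - C (a j)) := by
  induction s using Finset.induction_on_max with
  | empty => exact ⟨0, g, by simp⟩
  | insert b s hb ih =>
    obtain ⟨N, r, h⟩ := ih
    have hbs : b ∉ s := fun h => lt_irrefl _ (hb b h)
    have hdvd : X - C (a b) ∣ r - C (r.eval (a b)) := by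
      rw [dvd_iff_isRoot]; simp
    obtain ⟨r', hr'⟩ := hdvd
    refine ⟨Function.update N b (r.eval (a b)), r', ?_⟩
    have h1 : {j ∈ insert b s | j < b} = s := by
      ext j
      simp only [Finset.mem_filter, Finset.mem_insert]
      constructor
      · rintro ⟨rfl | h, h'⟩
        · exact absurd h' (lt_irrefl _)
        · exact h
      · exact fun h => ⟨Or.inr h, hb j h⟩
    have h2 : ∀ l ∈ s, {j ∈ insert b s | j < l} = {j ∈ s | j < l} := by
      intro l hl
      rw [Finset.filter_insert, if_neg (hb l hl).not_gt]
    rw [Finset.sum_insert hbs, Finset.prod_insert hbs, h1, Function.update_self]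
    have h3 : ∑ l ∈ s, C (Function.update N b (r.eval (a b)) l) *
        ∏ j ∈ insert b s with j < l, (X - C (a j)) =
        ∑ l ∈ s, C (N l) * ∏ j ∈ s with j < l, (X - C (a j)) := by
      refine Finset.sum_congr rfl fun l hl => ?_
      rw [h2 l hl, Function.update_of_ne (by rintro rfl; exact hbs hl)]
    rw [h3]
    have h4 : r = (X - C (a b)) * r' + C (r.eval (a b)) := by rw [← hr']; ring
    conv_lhs => rw [h, h4]
    ring

open Polynomial in
/-- A determinant whose rows are evaluations of polynomials, where rows of the same class share
their polynomials, is divisible by the Vandermonde products of the classes. -/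
theorem Matrix.prod_sub_dvd_det_eval {R ι κ : Type*} [CommRing R] [Fintype ι] [LinearOrder ι]
    [DecidableEq κ] (cls : ι → κ) (a : ι → R) (g : κ → ι → R[X]) :
    ∏ i, ∏ j with j < i ∧ cls j = cls i, (a i - a j) ∣
      (Matrix.of fun i j => (g (cls i) j).eval (a i)).det := by
  choose N r hNr using fun (c : κ) (j : ι) =>
    Polynomial.exists_newton_expansion a {i | cls i = c} (g c j)
  -- The Newton expansions factor the matrix into the lower triangular `T`, with the node
  -- polynomials of the class as entries, and the matrix `V` of the Newton coefficients.
  let T : Matrix ι ι R := Matrix.of fun i l =>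
    if cls l = cls i then ∏ j with cls j = cls i ∧ j < l, (a i - a j) else 0
  let V : Matrix ι ι R := Matrix.of fun l j => N (cls l) j l
  have hM : (Matrix.of fun i j => (g (cls i) j).eval (a i)) = T * V := by
    ext i j
    have h0 : ∏ l with cls l = cls i, (a i - a l) = 0 :=
      Finset.prod_eq_zero (i := i) (by simp) (sub_self _)
    simp only [Matrix.of_apply, Matrix.mul_apply, T, V]
    rw [hNr (cls i) j]
    simp only [eval_add, eval_finsetSum, eval_mul, eval_prod, eval_sub, eval_C, eval_X, h0,
      mul_zero, add_zero, ite_mul, zero_mul]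
    rw [Finset.sum_filter]
    refine Finset.sum_congr rfl fun l _ => ?_
    split_ifs with h
    · rw [Finset.filter_filter, h, mul_comm]
    · rfl
  have hT : T.BlockTriangular OrderDual.toDual := by
    intro i l hil
    have hil' : i < l := hil
    simp only [T, Matrix.of_apply]
    split_ifs with h
    · exact Finset.prod_eq_zero (i := i) (by simp [hil']) (sub_self _)
    · rfl
  rw [hM, Matrix.det_mul, Matrix.det_of_isLowerTriangular T hT]
  refine dvd_mul_of_dvd_left (dvd_of_eq ?_) _
  refine Finset.prod_congr rfl fun i _ => ?_
  simp only [T, Matrix.of_apply, if_true]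
  refine Finset.prod_congr ?_ fun _ _ => rfl
  ext j; simp [and_comm]

/-- Congruent elements have highly congruent powers: a `q`-th power gains a factor of `I`. -/
theorem Ideal.pow_sub_pow_mem_pow {R : Type*} [CommRing R] {I : Ideal R} {q : ℕ}
    (hq : (q : R) ∈ I) {a b : R} (h : a - b ∈ I) (n : ℕ) : a ^ q ^ n - b ^ q ^ n ∈ I ^ (n + 1) := by
  induction n with
  | zero => simpa using h
  | succ n ih =>
    have key : ∀ u v : R, u - v ∈ I → ∑ i ∈ Finset.range q, u ^ i * v ^ (q - 1 - i) ∈ I := by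
      intro u v huv
      rw [← Ideal.Quotient.eq_zero_iff_mem] at hq ⊢
      have huv' := (Ideal.Quotient.eq (I := I)).2 huv
      simp only [map_sum, map_mul, map_pow, huv', map_natCast] at hq ⊢
      rw [Finset.sum_congr rfl (g := fun _ => Ideal.Quotient.mk I v ^ (q - 1))]
      · simp [hq]
      · intro i hi
        rw [← pow_add]; congr 1
        have := Finset.mem_range.1 hi
        omega
    rw [pow_succ q, pow_mul, pow_mul, ← (Commute.all _ _).geom_sum₂_mul, mul_comm, pow_succ I]
    refine Ideal.mul_mem_mul ih (key _ _ ?_)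
    exact Ideal.pow_le_self (by omega) ih

theorem Ideal.mul_notMem_pow_of_notMem {A : Type*} [CommRing A] [IsDedekindDomain A] {P : Ideal A}
    [P.IsPrime] (hP : P ≠ ⊥) {a b : A} {m n : ℕ} (ha : a ∈ P ^ m) (ha' : a ∉ P ^ (m + 1))
    (hb : b ∈ P ^ n) (hb' : b ∉ P ^ (n + 1)) : a * b ∉ P ^ (m + n + 1) := by
  intro h
  rw [← Ideal.dvd_span_singleton] at ha hb h
  rw [← Ideal.span_singleton_mul_span_singleton] at h
  have hprime : Prime P := Ideal.prime_of_isPrime hP ‹_›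
  rcases succ_dvd_or_succ_dvd_of_succ_sum_dvd_mul hprime ha hb h with h1 | h1
  · exact ha' (Ideal.dvd_span_singleton.1 h1)
  · exact hb' (Ideal.dvd_span_singleton.1 h1)

/-- A truncated `P`-adic expansion whose digits are of the form `c ^ Q`, where `Q` is such that
`c ^ Q ≡ c` modulo `P`. -/
theorem Ideal.exists_expansion {A : Type*} [CommRing A] [IsDedekindDomain A] {P : Ideal A}
    [P.IsPrime] (hP : P ≠ ⊥) {Q : ℕ} (hQ : ∀ c : A, c ^ Q - c ∈ P) {ν π : A} {e : ℕ}
    (hν : ν ∈ P ^ e) (hν' : ν ∉ P ^ (e + 1)) (hπ : π ∈ P) (hπ' : π ∉ P ^ 2)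
    {x : A} (hx : x ∈ P ^ e) (n : ℕ) :
    ∃ c : ℕ → A, x - ν * ∑ k ∈ Finset.range n, c k ^ Q * π ^ k ∈ P ^ (e + n) := by
  induction n with
  | zero => exact ⟨0, by simpa using hx⟩
  | succ n ih =>
    obtain ⟨c, hc⟩ := ih
    have ha : ∀ k, ν * π ^ k ∈ P ^ (e + k) := fun k => by
      rw [pow_add]; exact Ideal.mul_mem_mul hν (Ideal.pow_mem_pow hπ k)
    have ha' : ∀ k, ν * π ^ k ∉ P ^ (e + k + 1) := by
      intro k
      induction k with
      | zero => simpa using hν'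
      | succ k ih =>
        rw [pow_succ π, ← mul_assoc ν]
        exact Ideal.mul_notMem_pow_of_notMem (n := 1) hP (ha k) ih (by simpa using hπ) hπ'
    obtain ⟨t, r, hr, htr⟩ := Ideal.exists_mul_add_mem_pow_succ hP _ _ (ha n) (ha' n) hc
    refine ⟨Function.update c n t, ?_⟩
    have hsum : ∑ k ∈ Finset.range n, Function.update c n t k ^ Q * π ^ k =
        ∑ k ∈ Finset.range n, c k ^ Q * π ^ k := by
      refine Finset.sum_congr rfl fun k hk => ?_
      rw [Function.update_of_ne (Finset.mem_range.1 hk).ne]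
    rw [Finset.sum_range_succ, hsum, Function.update_self]
    have : x - ν * (∑ k ∈ Finset.range n, c k ^ Q * π ^ k + t ^ Q * π ^ n) =
        r - ν * π ^ n * (t ^ Q - t) := by linear_combination -htr
    rw [this]
    refine Ideal.sub_mem _ hr ?_
    rw [← add_assoc, pow_succ]
    exact Ideal.mul_mem_mul (ha n) (hQ t)

open Polynomial in
/-- Ring homomorphisms `s` lifting a fixed homomorphism `φ` to `R ⧸ 𝔓` can be computed
simultaneously modulo `𝔓 ^ N` by evaluating one polynomial at the values `s π`. The digits of the
`ker φ`-adic expansion are replaced by high powers, on which all such `s` agree modulo `𝔓 ^ N`. -/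
theorem Ideal.exists_polynomial_of_ker {A R : Type*} [CommRing A] [CommRing R]
    [IsDedekindDomain A] [Ring.HasFiniteQuotients A] {𝔓 : Ideal R} [𝔓.IsPrime]
    (φ : A →+* R ⧸ 𝔓) (hφ : RingHom.ker φ ≠ ⊥) (e N : ℕ) :
    ∃ ν ∈ RingHom.ker φ ^ e, ∃ π : A, ∀ x ∈ RingHom.ker φ ^ e, ∃ g : R[X],
      ∀ s : A →+* R, (Ideal.Quotient.mk 𝔓).comp s = φ → s x - s ν * g.eval (s π) ∈ 𝔓 ^ N := by
  set P := RingHom.ker φ with hPdef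
  have hPp : P.IsPrime := RingHom.ker_isPrime φ
  have hmax : P.IsMaximal := hPp.isMaximal hφ
  have : Finite (A ⧸ P) := Ring.HasFiniteQuotients.finiteQuotient hφ
  let : Field (A ⧸ P) := Ideal.Quotient.field P
  let : Fintype (A ⧸ P) := Fintype.ofFinite _
  set q := Fintype.card (A ⧸ P)
  have hqP : (q : A) ∈ P := by
    rw [← Ideal.Quotient.eq_zero_iff_mem, map_natCast, FiniteField.cast_card_eq_zero]
  have hq𝔓 : (q : R) ∈ 𝔓 := by
    rw [← Ideal.Quotient.eq_zero_iff_mem, map_natCast, ← map_natCast φ]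
    exact hqP
  have hQ : ∀ c : A, c ^ q ^ N - c ∈ P := by
    intro c
    rw [← Ideal.Quotient.eq, map_pow, FiniteField.pow_card_pow]
  obtain ⟨ν, hν, hν'⟩ := SetLike.exists_of_lt (Ideal.pow_succ_lt_pow hφ e)
  obtain ⟨π, hπ, hπ'⟩ := SetLike.exists_of_lt (Ideal.pow_succ_lt_pow hφ 1)
  rw [pow_one] at hπ
  refine ⟨ν, hν, π, fun x hx => ?_⟩
  obtain ⟨c, hc⟩ := Ideal.exists_expansion hφ hQ hν hν' hπ hπ' hx N
  choose γ hγ using fun k => Ideal.Quotient.mk_surjective (φ (c k))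
  refine ⟨∑ k ∈ Finset.range N, C (γ k ^ q ^ N) * X ^ k, fun s hs => ?_⟩
  have hsP : P ≤ 𝔓.comap s := by
    intro a ha
    rw [Ideal.mem_comap, ← Ideal.Quotient.eq_zero_iff_mem, ← RingHom.comp_apply, hs]
    exact ha
  have h1 : s (x - ν * ∑ k ∈ Finset.range N, c k ^ q ^ N * π ^ k) ∈ 𝔓 ^ N := by
    have : P ^ (e + N) ≤ (𝔓 ^ N).comap s :=
      (Ideal.pow_le_pow_right (by omega)).trans
        ((Ideal.pow_right_mono hsP N).trans (Ideal.le_comap_pow s N))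
    exact this hc
  have h2 : ∀ k, s (c k) ^ q ^ N - γ k ^ q ^ N ∈ 𝔓 ^ N := by
    intro k
    refine Ideal.pow_le_pow_right (Nat.le_succ N) (Ideal.pow_sub_pow_mem_pow hq𝔓 ?_ N)
    rw [← Ideal.Quotient.eq, hγ, ← hs]; rfl
  simp only [eval_finsetSum, eval_mul, eval_C, eval_pow, eval_X]
  simp only [map_sub, map_mul, map_sum, map_pow] at h1
  have h3 : s ν * ∑ k ∈ Finset.range N, (s (c k) ^ q ^ N - γ k ^ q ^ N) * s π ^ k ∈ 𝔓 ^ N :=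
    Ideal.mul_mem_left _ _ (Ideal.sum_mem _ fun k _ => Ideal.mul_mem_right _ _ (h2 k))
  convert Ideal.add_mem _ h1 h3 using 1
  simp only [sub_mul, Finset.sum_sub_distrib]
  ring

/-- The ideal generated by the differences `s a - t a`; a prime contains it exactly when `s` and
`t` agree modulo that prime. -/
def diffIdeal {A R : Type*} [CommRing A] [CommRing R] (s t : A →+* R) : Ideal R :=
  Ideal.span (Set.range fun a => s a - t a)

section diffIdeal

variable {A R : Type*} [CommRing A] [CommRing R]

theorem sub_mem_diffIdeal (s t : A →+* R) (a : A) : s a - t a ∈ diffIdeal s t :=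
  Ideal.subset_span ⟨a, rfl⟩

theorem diffIdeal_le_iff {s t : A →+* R} {I : Ideal R} :
    diffIdeal s t ≤ I ↔ (Ideal.Quotient.mk I).comp s = (Ideal.Quotient.mk I).comp t := by
  rw [diffIdeal, Ideal.span_le, Set.range_subset_iff, RingHom.ext_iff]
  simp [Ideal.Quotient.eq]

theorem diffIdeal_comm (s t : A →+* R) : diffIdeal s t = diffIdeal t s := by
  have h : ∀ s t : A →+* R, diffIdeal s t ≤ diffIdeal t s := by
    intro s t
    rw [diffIdeal, Ideal.span_le, Set.range_subset_iff]
    intro a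
    rw [← neg_sub]
    exact (diffIdeal t s).neg_mem (sub_mem_diffIdeal t s a)
  exact le_antisymm (h s t) (h t s)

theorem diffIdeal_ne_bot {s t : A →+* R} (h : s ≠ t) : diffIdeal s t ≠ ⊥ := by
  intro h0
  refine h (RingHom.ext fun a => sub_eq_zero.1 ?_)
  have := sub_mem_diffIdeal s t a
  rwa [h0, Ideal.mem_bot] at this

end diffIdeal

open scoped Classical in
/-- The contribution of one prime `𝔓`: modulo every power of `𝔓`, a determinant `det (s i (x j))`
lies in the product of those factors of the expected ideal that matter at `𝔓`. -/
theorem det_mem_prod_diffIdeal_sup_pow {A R ι : Type*} [CommRing A] [CommRing R]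
    [IsDedekindDomain A] [Ring.HasFiniteQuotients A] [Fintype ι] [LinearOrder ι]
    (𝔓 : Ideal R) [𝔓.IsPrime] (s : ι → A →+* R) (hs : ∀ i, 𝔓.comap (s i) ≠ ⊥)
    (e : Ideal A → ℕ) (x : ι → A)
    (hx : ∀ i j, x j ∈ 𝔓.comap (s i) ^ e (𝔓.comap (s i))) (N : ℕ) :
    (Matrix.of fun i j => s i (x j)).det ∈
      (∏ i, (𝔓.comap (s i) ^ e (𝔓.comap (s i))).map (s i)) *
        (∏ i, ∏ j with j < i ∧ diffIdeal (s j) (s i) ≤ 𝔓, diffIdeal (s i) (s j)) ⊔ 𝔓 ^ N := by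
  let cls : ι → (A →+* R ⧸ 𝔓) := fun i => (Ideal.Quotient.mk 𝔓).comp (s i)
  have hker : ∀ i, RingHom.ker (cls i) = 𝔓.comap (s i) := by
    intro i
    ext a
    rw [RingHom.mem_ker, Ideal.mem_comap, ← Ideal.Quotient.eq_zero_iff_mem]; rfl
  have H : ∀ φ : A →+* R ⧸ 𝔓, ∃ (ν π : A) (g : ι → Polynomial R), ∀ i, cls i = φ →
      ν ∈ 𝔓.comap (s i) ^ e (𝔓.comap (s i)) ∧
      ∀ j, s i (x j) - s i ν * (g j).eval (s i π) ∈ 𝔓 ^ N := by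
    intro φ
    by_cases h : ∃ i, cls i = φ
    · obtain ⟨i, rfl⟩ := h
      obtain ⟨ν, hν, π, hg⟩ := Ideal.exists_polynomial_of_ker (cls i) (by rw [hker]; exact hs i)
        (e (𝔓.comap (s i))) N
      choose g hg using fun j => hg (x j) (by rw [hker]; exact hx i j)
      refine ⟨ν, π, g, fun i' hi' => ⟨?_, fun j => hg j (s i') hi'⟩⟩
      rw [← hker i', hi', hker i]
      rwa [hker] at hν
    · exact ⟨0, 0, 0, fun i hi => absurd ⟨i, hi⟩ h⟩
  choose ν π g hg using H
  have hν := fun i => (hg (cls i) i rfl).1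
  have hx' := fun i => (hg (cls i) i rfl).2
  -- Modulo `𝔓 ^ N` the matrix is `M'`, whose rows are polynomial evaluations, class by class.
  set M' : Matrix ι ι R :=
    Matrix.of fun i j => s i (ν (cls i)) * (g (cls i) j).eval (s i (π (cls i)))
  have hdet : (Matrix.of fun i j => s i (x j)).det - M'.det ∈ 𝔓 ^ N := by
    rw [← Ideal.Quotient.eq, RingHom.map_det, RingHom.map_det]
    congr 1
    ext i j
    exact Ideal.Quotient.eq.2 (hx' i j)
  have hM' : M'.det ∈ (∏ i, (𝔓.comap (s i) ^ e (𝔓.comap (s i))).map (s i)) *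
        (∏ i, ∏ j with j < i ∧ diffIdeal (s j) (s i) ≤ 𝔓, diffIdeal (s i) (s j)) := by
    have h1 : M'.det = (∏ i, s i (ν (cls i))) *
        (Matrix.of fun i j => (g (cls i) j).eval (s i (π (cls i)))).det :=
      Matrix.det_mul_column _ _
    rw [h1]
    refine Ideal.mul_mem_mul (Ideal.prod_mem_prod fun i _ => Ideal.mem_map_of_mem _ (hν i)) ?_
    refine Ideal.mem_of_dvd _ (Matrix.prod_sub_dvd_det_eval cls _ g) ?_
    refine Ideal.prod_mem_prod fun i _ => ?_
    have h2 : ∀ j, diffIdeal (s j) (s i) ≤ 𝔓 ↔ cls j = cls i := fun j => diffIdeal_le_iff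
    simp only [h2]
    refine Ideal.prod_mem_prod fun j hj => ?_
    rw [(Finset.mem_filter.1 hj).2.2]
    exact sub_mem_diffIdeal _ _ _
  rw [← sub_add_cancel (Matrix.det _) M'.det]
  exact Ideal.add_mem _ (Ideal.mem_sup_right hdet) (Ideal.mem_sup_left hM')

open scoped Classical in
/-- A determinant `det (s i (x j))` with entries from an ideal `𝔫` is divisible by the images of
`𝔫` and by all the ideals measuring the congruences between the `s i`. -/
theorem det_mem_prod_diffIdeal {A R ι : Type*} [CommRing A] [CommRing R]
    [IsDedekindDomain A] [Ring.HasFiniteQuotients A] [IsDedekindDomain R] [Fintype ι]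
    [LinearOrder ι] (s : ι → A →+* R) (hinj : ∀ i, Function.Injective (s i))
    (hcomap : ∀ (P : Ideal R) (i), P.IsPrime → P ≠ ⊥ → P.comap (s i) ≠ ⊥)
    (hs : Function.Injective s) {𝔫 : Ideal A} (h𝔫 : 𝔫 ≠ ⊥) (x : ι → A) (hx : ∀ j, x j ∈ 𝔫) :
    (Matrix.of fun i j => s i (x j)).det ∈
      (∏ i, 𝔫.map (s i)) * (∏ i, ∏ j with j < i, diffIdeal (s i) (s j)) := by
  rw [← Ideal.dvd_span_singleton]
  have hmap : ∀ i, ∀ I : Ideal A, I ≠ ⊥ → I.map (s i) ≠ ⊥ := fun i I hI => by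
    rwa [Ne, Ideal.map_eq_bot_iff_of_injective (hinj i)]
  have hD : ∏ i, ∏ j with j < i, diffIdeal (s i) (s j) ≠ 0 := by
    refine Finset.prod_ne_zero_iff.2 fun i _ => Finset.prod_ne_zero_iff.2 fun j hj => ?_
    exact diffIdeal_ne_bot (hs.ne (Finset.mem_filter.1 hj).2.ne')
  have hI : (∏ i, 𝔫.map (s i)) * (∏ i, ∏ j with j < i, diffIdeal (s i) (s j)) ≠ 0 :=
    mul_ne_zero (Finset.prod_ne_zero_iff.2 fun i _ => hmap i _ h𝔫) hD
  rw [UniqueFactorizationMonoid.dvd_iff_emultiplicity_le hI]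
  intro 𝔓 h𝔓
  have hfin := FiniteMultiplicity.of_prime_left h𝔓 hI
  rw [hfin.emultiplicity_eq_multiplicity, ← pow_dvd_iff_le_emultiplicity]
  set N := multiplicity 𝔓 ((∏ i, 𝔫.map (s i)) * (∏ i, ∏ j with j < i, diffIdeal (s i) (s j)))
  have hdvd : 𝔓 ^ N ∣ _ := pow_multiplicity_dvd 𝔓 _
  have h𝔓' : 𝔓.IsPrime := Ideal.isPrime_of_prime h𝔓
  have hPi : ∀ i, Prime (𝔓.comap (s i)) := fun i =>
    Ideal.prime_of_isPrime (hcomap 𝔓 i h𝔓' h𝔓.ne_zero) inferInstance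
  -- Split off the factors of the expected ideal that are prime to `𝔓`.
  have H := fun i => (FiniteMultiplicity.of_prime_left (hPi i) h𝔫).exists_eq_pow_mul_and_not_dvd
  choose 𝔫' h𝔫' hndvd using H
  have hfac1 : ∏ i, 𝔫.map (s i) =
      (∏ i, (𝔓.comap (s i) ^ multiplicity (𝔓.comap (s i)) 𝔫).map (s i)) *
        ∏ i, (𝔫' i).map (s i) := by
    rw [← Finset.prod_mul_distrib]
    refine Finset.prod_congr rfl fun i _ => ?_
    conv_lhs => rw [h𝔫' i]
    rw [Ideal.map_mul]
  have hfac2 : ∏ i, ∏ j with j < i, diffIdeal (s i) (s j) =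
      (∏ i, ∏ j with j < i ∧ diffIdeal (s j) (s i) ≤ 𝔓, diffIdeal (s i) (s j)) *
        ∏ i, ∏ j with j < i ∧ ¬ diffIdeal (s j) (s i) ≤ 𝔓, diffIdeal (s i) (s j) := by
    rw [← Finset.prod_mul_distrib]
    refine Finset.prod_congr rfl fun i _ => ?_
    rw [← Finset.filter_filter, ← Finset.filter_filter, Finset.prod_filter_mul_prod_filter_not]
  have hn1 : ¬ 𝔓 ∣ ∏ i, (𝔫' i).map (s i) := by
    rw [h𝔓.dvd_finsetProd_iff]
    rintro ⟨i, -, hi⟩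
    exact hndvd i (Ideal.dvd_iff_le.2 (Ideal.map_le_iff_le_comap.1 (Ideal.dvd_iff_le.1 hi)))
  have hn2 : ¬ 𝔓 ∣
      ∏ i, ∏ j with j < i ∧ ¬ diffIdeal (s j) (s i) ≤ 𝔓, diffIdeal (s i) (s j) := by
    rw [h𝔓.dvd_finsetProd_iff]
    rintro ⟨i, -, hi⟩
    rw [h𝔓.dvd_finsetProd_iff] at hi
    obtain ⟨j, hj, hi⟩ := hi
    refine (Finset.mem_filter.1 hj).2.2 ?_
    rw [diffIdeal_comm]
    exact Ideal.dvd_iff_le.1 hi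
  rw [hfac1, hfac2, mul_mul_mul_comm] at hdvd
  have hdvd' := h𝔓.pow_dvd_of_dvd_mul_right N
    (fun h => (h𝔓.dvd_or_dvd h).elim hn1 hn2) hdvd
  have hloc := det_mem_prod_diffIdeal_sup_pow 𝔓 s (fun i => (hPi i).ne_zero)
    (fun P => multiplicity P 𝔫) x
    (fun i j => Ideal.dvd_iff_le.1 (pow_multiplicity_dvd _ _) (hx j)) N
  rw [Ideal.dvd_span_singleton]
  exact (sup_le (Ideal.dvd_iff_le.1 hdvd') le_rfl : _ ≤ 𝔓 ^ N) hloc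

/-! ### The product of all congruence ideals -/

/-- The `R`-span of the vectors `(s i a)_i` is a ring, and it is spanned by the images of a
`ℤ`-basis. -/
theorem exists_coeff_of_mem_adjoin {A R ι : Type*} [CommRing A] [CommRing R] [Fintype ι]
    (ω : Module.Basis ι ℤ A) (s : ι → A →+* R) {f : ι → R}
    (hf : f ∈ Algebra.adjoin R (Set.range (RingHom.pi s))) :
    ∃ c : ι → R, ∀ i, f i = ∑ l, s i (ω l) * c l := by
  rw [← Subalgebra.mem_toSubmodule, Algebra.adjoin_eq_span] at hf
  have hcl : Submonoid.closure (Set.range (RingHom.pi s)) =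
      MonoidHom.mrange (RingHom.pi s : A →* ι → R) :=
    Submonoid.closure_eq (MonoidHom.mrange (RingHom.pi s : A →* ι → R))
  rw [hcl] at hf
  induction hf using Submodule.span_induction with
  | mem f hf =>
    obtain ⟨a, rfl⟩ := hf
    refine ⟨fun l => (ω.repr a l : R), fun i => ?_⟩
    change s i a = _
    conv_lhs => rw [← ω.sum_repr a]
    simp [mul_comm]
  | zero => exact ⟨0, by simp⟩
  | add f g _ _ hf hg =>
    obtain ⟨c, hc⟩ := hf
    obtain ⟨c', hc'⟩ := hg
    exact ⟨c + c', fun i => by simp [hc, hc', mul_add, Finset.sum_add_distrib]⟩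
  | smul r f _ hf =>
    obtain ⟨c, hc⟩ := hf
    exact ⟨r • c, fun i => by simp [hc, Finset.mul_sum, mul_left_comm]⟩

/-- The vectors `∏ j < k, (s i a - s j a)_i` of the ring spanned by the `(s i a)_i` form a
triangular matrix, whose determinant is a multiple of `det (s i (ω l))`. -/
theorem det_dvd_prod_sub {A R ι : Type*} [CommRing A] [CommRing R] [Fintype ι] [LinearOrder ι]
    (ω : Module.Basis ι ℤ A) (s : ι → A →+* R) (a : ι → ι → A) :
    (Matrix.of fun i l => s i (ω l)).det ∣ ∏ i, ∏ j with j < i, (s i (a i j) - s j (a i j)) := by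
  let f : ι → ι → R := fun k =>
    ∏ j with j < k, (RingHom.pi s (a k j) - algebraMap R (ι → R) (s j (a k j)))
  have hf : ∀ k, f k ∈ Algebra.adjoin R (Set.range (RingHom.pi s)) := fun k =>
    Subalgebra.prod_mem _ fun j _ =>
      Subalgebra.sub_mem _ (Algebra.subset_adjoin ⟨_, rfl⟩) (Subalgebra.algebraMap_mem _ _)
  have hfi : ∀ k i, f k i = ∏ j with j < k, (s i (a k j) - s j (a k j)) := fun k i => by
    simp only [f, Finset.prod_apply, Pi.sub_apply]
    rfl
  choose c hc using fun k => exists_coeff_of_mem_adjoin ω s (hf k)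
  have hM : (Matrix.of fun i k => f k i) =
      (Matrix.of fun i l => s i (ω l)) * Matrix.of fun l k => c k l := by
    ext i k
    simp [Matrix.mul_apply, hc]
  have hT : (Matrix.of fun i k => f k i).BlockTriangular OrderDual.toDual := by
    intro i k hik
    have hik' : i < k := hik
    rw [Matrix.of_apply, hfi]
    exact Finset.prod_eq_zero (i := i) (by simp [hik']) (sub_self _)
  have hdet := Matrix.det_of_isLowerTriangular _ hT
  simp only [Matrix.of_apply, hfi] at hdet
  rw [← hdet]
  have := congrArg Matrix.det hM
  rw [Matrix.det_mul] at this
  simp only [hfi] at this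
  exact Dvd.intro _ this.symm

/-- The product is generated by products of differences, one for each pair. -/
theorem prod_diffIdeal_le_span_det {A R ι : Type*} [CommRing A] [CommRing R] [Fintype ι]
    [LinearOrder ι] (ω : Module.Basis ι ℤ A) (s : ι → A →+* R) :
    ∏ i, ∏ j with j < i, diffIdeal (s i) (s j) ≤
      Ideal.span {(Matrix.of fun i l => s i (ω l)).det} := by
  simp only [diffIdeal, Ideal.prod_span]
  rw [Ideal.span_le]
  intro z hz
  rw [Set.mem_finsetProd] at hz
  obtain ⟨g, hg, rfl⟩ := hz
  have hg' : ∀ i, ∃ b : ι → A, g i = ∏ j with j < i, (s i (b j) - s j (b j)) := by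
    intro i
    obtain ⟨h, hh, hgi⟩ := (Set.mem_finsetProd _ _ _).1 (hg (Finset.mem_univ i))
    choose! b hb using fun j hj => hh (i := j) hj
    exact ⟨b, hgi ▸ Finset.prod_congr rfl fun j hj => (hb j hj).symm⟩
  choose b hb using hg'
  rw [SetLike.mem_coe, Ideal.mem_span_singleton, Finset.prod_congr rfl fun i _ => hb i]
  exact det_dvd_prod_sub ω s b

/-- For a ring with a `ℤ`-basis `ω` the congruence ideals multiply to the square root
`det (s i (ω l))` of the discriminant. -/
theorem prod_diffIdeal_eq_span_det {A R ι : Type*} [CommRing A] [CommRing R]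
    [IsDedekindDomain A] [Ring.HasFiniteQuotients A] [IsDedekindDomain R] [Fintype ι]
    [LinearOrder ι] (ω : Module.Basis ι ℤ A) (s : ι → A →+* R)
    (hinj : ∀ i, Function.Injective (s i))
    (hcomap : ∀ (P : Ideal R) (i), P.IsPrime → P ≠ ⊥ → P.comap (s i) ≠ ⊥)
    (hs : Function.Injective s) :
    ∏ i, ∏ j with j < i, diffIdeal (s i) (s j) =
      Ideal.span {(Matrix.of fun i l => s i (ω l)).det} := by
  refine le_antisymm (prod_diffIdeal_le_span_det ω s) ?_
  rw [Ideal.span_singleton_le_iff_mem]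
  have := det_mem_prod_diffIdeal s hinj hcomap hs (𝔫 := ⊤) top_ne_bot ω fun _ => trivial
  rwa [Finset.prod_eq_one fun i _ => by rw [Ideal.map_top, Ideal.one_eq_top], one_mul] at this

noncomputable section

open NumberField IdealBox

/-! ### Embeddings into the compositum and norms -/

theorem Ideal.absNorm_map_ringEquiv {R S : Type*} [CommRing R] [IsDedekindDomain R]
    [Module.Free ℤ R] [CommRing S] [IsDedekindDomain S] [Module.Free ℤ S] (e : R ≃+* S)
    (I : Ideal R) : Ideal.absNorm (I.map (e : R →+* S)) = Ideal.absNorm I := by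
  rw [Ideal.absNorm_apply, Ideal.absNorm_apply, Submodule.cardQuot_apply,
    Submodule.cardQuot_apply]
  exact Nat.card_congr (Ideal.quotientEquiv I _ e rfl).toEquiv.symm

namespace IdealBox

variable {k : Type*} [Field k] [NumberField k]

instance : NumberField (galoisClosure k) where
  to_finiteDimensional :=
    inferInstanceAs (FiniteDimensional ℚ (IntermediateField.normalClosure ℚ k ℂ))

instance : IsGalois ℚ (galoisClosure k) where
  to_normal := (Algebra.IsAlgebraic.isNormalClosure_normalClosure fun _ =>
    IsAlgClosed.splits _ : IsNormalClosure ℚ k (galoisClosure k)).normal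

/-- An embedding of `k`, restricted to the rings of integers of `k` and of the compositum. -/
def intEmbedding (σ : k →+* ℂ) : 𝓞 k →+* 𝓞 (galoisClosure k) :=
  RingOfIntegers.mapRingHom (toClosure σ)

theorem coe_intEmbedding (σ : k →+* ℂ) (x : 𝓞 k) :
    (((intEmbedding σ x : 𝓞 (galoisClosure k)) : galoisClosure k) : ℂ) = σ x := rfl

theorem intEmbedding_injective : Function.Injective (intEmbedding (k := k)) := by
  intro σ τ h
  ext x
  obtain ⟨a, b, -, rfl⟩ := IsFractionRing.div_surjective (A := 𝓞 k) x
  have h' : ∀ a : 𝓞 k, σ a = τ a := fun a => by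
    rw [← coe_intEmbedding, h, coe_intEmbedding]
  rw [map_div₀, map_div₀]
  exact congrArg₂ _ (h' a) (h' b)

theorem intEmbedding_apply_injective (σ : k →+* ℂ) : Function.Injective (intEmbedding σ) := by
  intro x y h
  have : σ x = σ y := by rw [← coe_intEmbedding, h, coe_intEmbedding]
  exact RingOfIntegers.ext (σ.injective this)

theorem comap_intEmbedding_ne_bot (P : Ideal (𝓞 (galoisClosure k))) (σ : k →+* ℂ)
    (hP : P ≠ ⊥) : P.comap (intEmbedding σ) ≠ ⊥ := by
  intro h
  have h1 : ((Ideal.absNorm P : ℕ) : 𝓞 k) ∈ P.comap (intEmbedding σ) := by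
    rw [Ideal.mem_comap, map_natCast]
    exact Ideal.absNorm_mem P
  rw [h, Ideal.mem_bot, Nat.cast_eq_zero, Ideal.absNorm_eq_zero_iff] at h1
  exact hP h1

/-- The Galois group permutes the embeddings transitively. -/
theorem exists_smul_eq (σ τ : k →+* ℂ) : ∃ g : galoisGroup k, g • σ = τ := by
  let σ' : k →ₐ[ℚ] galoisClosure k := (toClosure σ).toRatAlgHom
  let τ' : k →ₐ[ℚ] galoisClosure k := (toClosure τ).toRatAlgHom
  let eσ : k ≃ₐ[ℚ] σ'.fieldRange := AlgEquiv.ofInjectiveField σ'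
  let eτ : k ≃ₐ[ℚ] τ'.fieldRange := AlgEquiv.ofInjectiveField τ'
  refine ⟨(eσ.symm.trans eτ).liftNormal (galoisClosure k), ?_⟩
  ext x
  rw [smul_apply]
  have := (eσ.symm.trans eτ).liftNormal_commutes (galoisClosure k) (eσ x)
  rw [AlgEquiv.trans_apply, AlgEquiv.symm_apply_apply] at this
  exact congrArg Subtype.val this

theorem intEmbedding_smul (g : galoisGroup k) (σ : k →+* ℂ) :
    intEmbedding (g • σ) =
      (RingOfIntegers.mapRingEquiv (g : galoisClosure k ≃+* galoisClosure k) :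
        𝓞 (galoisClosure k) →+* 𝓞 (galoisClosure k)).comp (intEmbedding σ) := by
  ext x; rfl

theorem absNorm_diffIdeal_smul (g : galoisGroup k) (σ τ : k →+* ℂ) :
    Ideal.absNorm (diffIdeal (intEmbedding (g • σ)) (intEmbedding (g • τ))) =
      Ideal.absNorm (diffIdeal (intEmbedding σ) (intEmbedding τ)) := by
  rw [← Ideal.absNorm_map_ringEquiv
    (RingOfIntegers.mapRingEquiv (g : galoisClosure k ≃+* galoisClosure k))
    (diffIdeal (intEmbedding σ) (intEmbedding τ))]
  congr 1
  rw [diffIdeal, diffIdeal, Ideal.map_span, ← Set.range_comp]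
  congr 2
  ext x
  simp [intEmbedding_smul]

theorem absNorm_span_singleton_eq_prod (y : 𝓞 (galoisClosure k)) :
    (Ideal.absNorm (Ideal.span {y}) : ℝ) =
      ∏ g : galoisGroup k, ‖((g (y : galoisClosure k) : galoisClosure k) : ℂ)‖ := by
  rw [Ideal.absNorm_span_singleton, ← norm_prod]
  have h := Algebra.norm_eq_prod_automorphisms ℚ (L := galoisClosure k) (y : galoisClosure k)
  rw [← Algebra.coe_norm_int] at h
  have h' := congrArg (fun z : galoisClosure k => ‖(z : ℂ)‖) h
  have e1 : ‖((algebraMap ℚ (galoisClosure k) (Algebra.norm ℤ y : ℚ) : galoisClosure k) : ℂ)‖ =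
      ((Algebra.norm ℤ y).natAbs : ℝ) := by
    simp [Nat.cast_natAbs]
  rw [← e1]
  refine h'.trans ?_
  congr 1
  exact map_prod (galoisClosure k).val _ _

/-- The extension of `𝔫` to the compositum has absolute norm `N(𝔫) ^ [K : σ k]`; raising to the
power `[k : ℚ]` avoids naming the relative degree. -/
theorem absNorm_map_intEmbedding_pow (σ : k →+* ℂ) (𝔫 : Ideal (𝓞 k)) :
    Ideal.absNorm (𝔫.map (intEmbedding σ)) ^ Module.finrank ℚ k =
      Ideal.absNorm 𝔫 ^ Fintype.card (galoisGroup k) := by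
  let : Algebra k (galoisClosure k) := (toClosure σ).toAlgebra
  have : IsScalarTower ℚ k (galoisClosure k) :=
    IsScalarTower.of_algebraMap_eq' (Subsingleton.elim _ _)
  have hmap : algebraMap (𝓞 k) (𝓞 (galoisClosure k)) = intEmbedding σ := by
    ext x; rfl
  rw [← hmap, Ideal.absNorm_algebraMap, ← pow_mul, ← Nat.card_eq_fintype_card,
    IsGalois.card_aut_eq_finrank, ← Module.finrank_mul_finrank ℚ k (galoisClosure k), mul_comm]
  congr 2
  exact (IsFractionRing.finrank_eq ..).symm

end IdealBox

/-! ### Logarithmic norms of congruence ideals and of minors -/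

namespace IdealBox

variable {k : Type*} [Field k] [NumberField k]

/-- Averaging over the Galois group amounts to averaging over the embeddings. -/
theorem card_mul_sum_smul (F : (k →+* ℂ) → ℝ) (σ : k →+* ℂ) :
    (Module.finrank ℚ k : ℝ) * ∑ g : galoisGroup k, F (g • σ) =
      Fintype.card (galoisGroup k) * ∑ τ, F τ := by
  have hconst : ∀ τ, ∑ g : galoisGroup k, F (g • τ) = ∑ g : galoisGroup k, F (g • σ) := by
    intro τ
    obtain ⟨h, rfl⟩ := exists_smul_eq σ τ
    simp only [smul_smul]
    exact Fintype.sum_equiv (Equiv.mulRight h) _ _ fun g => rfl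
  calc (Module.finrank ℚ k : ℝ) * ∑ g : galoisGroup k, F (g • σ)
      = ∑ τ : k →+* ℂ, ∑ g : galoisGroup k, F (g • τ) := by
        rw [Finset.sum_congr rfl fun τ _ => hconst τ, Finset.sum_const, Finset.card_univ,
          Embeddings.card, nsmul_eq_mul]
    _ = ∑ g : galoisGroup k, ∑ τ : k →+* ℂ, F (g • τ) := Finset.sum_comm
    _ = ∑ g : galoisGroup k, ∑ τ : k →+* ℂ, F τ :=
        Finset.sum_congr rfl fun g _ => Equiv.sum_comp (MulAction.toPerm g) F
    _ = _ := by rw [Finset.sum_const, Finset.card_univ, nsmul_eq_mul]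

/-- The normalized logarithmic size of the congruence ideal of two embeddings. On the diagonal the
ideal is zero, and the convention `Real.log 0 = 0` makes the value zero. -/
def logDiff (σ τ : k →+* ℂ) : ℝ :=
  Real.log (Ideal.absNorm (diffIdeal (intEmbedding σ) (intEmbedding τ))) /
    Fintype.card (galoisGroup k)

theorem logDiff_self (σ : k →+* ℂ) : logDiff σ σ = 0 := by
  have : diffIdeal (intEmbedding σ) (intEmbedding σ) = ⊥ := by
    rw [diffIdeal, Ideal.span_eq_bot]
    rintro _ ⟨a, rfl⟩
    exact sub_self _
  simp [logDiff, this]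

theorem logDiff_comm (σ τ : k →+* ℂ) : logDiff σ τ = logDiff τ σ := by
  rw [logDiff, diffIdeal_comm, logDiff]

theorem logDiff_nonneg (σ τ : k →+* ℂ) : 0 ≤ logDiff σ τ :=
  div_nonneg (Real.log_natCast_nonneg _) (Nat.cast_nonneg _)

theorem logDiff_smul (g : galoisGroup k) (σ τ : k →+* ℂ) :
    logDiff (g • σ) (g • τ) = logDiff σ τ := by
  rw [logDiff, absNorm_diffIdeal_smul, logDiff]

theorem card_galoisGroup_pos : (0 : ℝ) < Fintype.card (galoisGroup k) :=
  Nat.cast_pos.2 Fintype.card_pos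

/-- The sum over unordered pairs is half of the sum over ordered pairs. -/
theorem sum_sum_logDiff_lt {m : ℕ} (f : Fin m → k →+* ℂ) :
    2 * ∑ i, ∑ j with j < i, logDiff (f i) (f j) = ∑ i, ∑ j, logDiff (f i) (f j) := by
  have h1 : ∀ i, ∑ j, logDiff (f i) (f j) =
      ∑ j with j < i, logDiff (f i) (f j) + ∑ j with i < j, logDiff (f i) (f j) := by
    intro i
    rw [Finset.sum_filter, Finset.sum_filter, ← Finset.sum_add_distrib]
    refine Finset.sum_congr rfl fun j _ => ?_
    rcases lt_trichotomy i j with h | rfl | h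
    · simp [h, h.not_gt]
    · simp [logDiff_self]
    · simp [h, h.not_gt]
  rw [Finset.sum_congr rfl fun i _ => h1 i, Finset.sum_add_distrib, two_mul]
  congr 1
  simp only [Finset.sum_filter]
  rw [Finset.sum_comm]
  refine Finset.sum_congr rfl fun i _ => Finset.sum_congr rfl fun j _ => ?_
  rw [logDiff_comm]

theorem log_absNorm_prod_diffIdeal {m : ℕ} {f : Fin m → k →+* ℂ} (hf : Function.Injective f) :
    Real.log (Ideal.absNorm
      (∏ i, ∏ j with j < i, diffIdeal (intEmbedding (f i)) (intEmbedding (f j)))) =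
      Fintype.card (galoisGroup k) * ((∑ i, ∑ j, logDiff (f i) (f j)) / 2) := by
  have hne : ∀ i, ∀ j ∈ ({j | j < i} : Finset (Fin m)),
      ((Ideal.absNorm (diffIdeal (intEmbedding (f i)) (intEmbedding (f j))) : ℕ) : ℝ) ≠ 0 := by
    intro i j hj
    rw [Nat.cast_ne_zero, Ne, Ideal.absNorm_eq_zero_iff]
    exact diffIdeal_ne_bot ((intEmbedding_injective.comp hf).ne (Finset.mem_filter.1 hj).2.ne')
  have hG := (card_galoisGroup_pos (k := k)).ne'
  simp only [map_prod, Nat.cast_prod]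
  rw [Real.log_prod fun i _ => Finset.prod_ne_zero_iff.2 (hne i),
    Finset.sum_congr rfl fun i _ => Real.log_prod (hne i), ← sum_sum_logDiff_lt f]
  simp only [logDiff, ← Finset.sum_div]
  field_simp

/-- The conjugates of a minor are the minors formed with the translated embeddings. -/
theorem coe_det_intEmbedding {ι : Type*} [Fintype ι] [DecidableEq ι] (f : ι → k →+* ℂ)
    (x : ι → 𝓞 k) (g : galoisGroup k) :
    ((g ((Matrix.of fun i j => intEmbedding (f i) (x j)).det : galoisClosure k) :
      galoisClosure k) : ℂ) = (Matrix.of fun i j => (g • f i) (x j)).det := by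
  let φ : 𝓞 (galoisClosure k) →+* ℂ :=
    ((galoisClosure k).val : galoisClosure k →+* ℂ).comp
      ((g : galoisClosure k →+* galoisClosure k).comp (algebraMap _ _))
  change φ _ = _
  rw [RingHom.map_det]
  rfl

theorem sq_det_intEmbedding_basis {ι : Type*} [Fintype ι] [DecidableEq ι]
    (f : ι ≃ (k →+* ℂ)) (ω : Module.Basis ι ℤ (𝓞 k)) :
    (Matrix.of fun i l => intEmbedding (f i) (ω l)).det ^ 2 =
      ((discr k : ℤ) : 𝓞 (galoisClosure k)) := by
  apply RingOfIntegers.ext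
  apply Subtype.ext
  have h1 := coe_det_intEmbedding f ω 1
  rw [AlgEquiv.one_apply] at h1
  have h2 := Algebra.discr_eq_det_embeddingsMatrixReindex_pow_two ℚ ℂ
    (ω.localizationLocalization ℚ (nonZeroDivisors ℤ) k) (f.trans (RingHom.equivRatAlgHom k ℂ))
  have h3 : Algebra.embeddingsMatrixReindex ℚ ℂ
      (ω.localizationLocalization ℚ (nonZeroDivisors ℤ) k)
      (f.trans (RingHom.equivRatAlgHom k ℂ)) =
      (Matrix.of fun i l => ((1 : galoisGroup k) • f i) (ω l)).transpose := by
    ext i j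
    simp [Algebra.embeddingsMatrixReindex, Algebra.embeddingsMatrix]
  rw [h3, Matrix.det_transpose, ← h1, Algebra.discr_localizationLocalization, discr_eq_discr] at h2
  simp only [map_pow, map_intCast, eq_intCast] at h2 ⊢
  push_cast
  exact h2.symm

/-- The congruence ideals of all pairs of embeddings account exactly for the discriminant. -/
theorem sum_sum_logDiff :
    ∑ σ : k →+* ℂ, ∑ τ, logDiff σ τ = Real.log |(discr k : ℝ)| := by
  have hcard : Fintype.card (k →+* ℂ) = Fintype.card (Module.Free.ChooseBasisIndex ℤ (𝓞 k)) := by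
    rw [Embeddings.card, ← Module.finrank_eq_card_chooseBasisIndex, RingOfIntegers.rank]
  let f : Fin (Fintype.card (k →+* ℂ)) ≃ (k →+* ℂ) := (Fintype.equivFin _).symm
  let ω := (RingOfIntegers.basis k).reindex (((Fintype.equivFin _).trans (finCongr hcard.symm)))
  have h1 := log_absNorm_prod_diffIdeal f.injective
  rw [prod_diffIdeal_eq_span_det ω (fun i => intEmbedding (f i))
    (fun i => intEmbedding_apply_injective _) (fun P i _ hP => comap_intEmbedding_ne_bot P _ hP)
    (intEmbedding_injective.comp f.injective)] at h1
  have h2 : (Ideal.absNorm (Ideal.span {(Matrix.of fun i l => intEmbedding (f i) (ω l)).det}) : ℝ)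
      ^ 2 = |(discr k : ℝ)| ^ Fintype.card (galoisGroup k) := by
    rw [← Nat.cast_pow, ← map_pow, Ideal.span_singleton_pow, sq_det_intEmbedding_basis,
      absNorm_span_singleton_eq_prod]
    simp
  have h3 := congrArg Real.log h2
  rw [Real.log_pow, Real.log_pow, h1] at h3
  have h4 : ∑ i, ∑ j, logDiff (f i) (f j) = ∑ σ : k →+* ℂ, ∑ τ, logDiff σ τ := by
    rw [← Equiv.sum_comp f]
    exact Finset.sum_congr rfl fun i _ => Equiv.sum_comp f _
  rw [h4] at h3
  have hG := (card_galoisGroup_pos (k := k)).ne'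
  push_cast at h3
  exact mul_left_cancel₀ hG (by linarith)

/-- The arithmetic lower bound for a determinant with entries in `𝔫`, played off against an
archimedean upper bound for all its conjugates. -/
theorem log_absNorm_add_sum_logDiff_le {𝔫 : Ideal (𝓞 k)} (h𝔫 : 𝔫 ≠ ⊥) {B : (k →+* ℂ) → ℝ}
    (hB : ∀ σ, 0 < B σ) {m : ℕ} {f : Fin m → k →+* ℂ} (hf : Function.Injective f)
    {x : Fin m → 𝓞 k} (hx : ∀ j, x j ∈ 𝔫) (hdet : (Matrix.of fun i j => f i (x j)).det ≠ 0)
    {κ : ℝ} (hκ : ∀ h : Fin m → k →+* ℂ,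
      ‖(Matrix.of fun i j => h i (x j)).det‖ ≤ κ * ∏ i, B (h i)) :
    m * Real.log (Ideal.absNorm 𝔫) +
        Module.finrank ℚ k * ((∑ i, ∑ j, logDiff (f i) (f j)) / 2) ≤
      Module.finrank ℚ k * Real.log κ + m * ∑ σ, Real.log (B σ) := by
  set G := galoisGroup k
  set y : 𝓞 (galoisClosure k) := (Matrix.of fun i j => intEmbedding (f i) (x j)).det with hy
  have hd : (0 : ℝ) < Module.finrank ℚ k := Nat.cast_pos.2 Module.finrank_pos
  have hG := card_galoisGroup_pos (k := k)
  have hy0 : y ≠ 0 := by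
    intro h0
    apply hdet
    have h1 := coe_det_intEmbedding f x 1
    rw [← hy, h0] at h1
    simpa using h1.symm
  have hκ0 : 0 < κ := by
    have h1 := (norm_pos_iff.2 hdet).trans_le (hκ f)
    exact pos_of_mul_pos_left h1 (Finset.prod_nonneg fun i _ => (hB _).le)
  have hmem := det_mem_prod_diffIdeal (fun i => intEmbedding (f i))
    (fun i => intEmbedding_apply_injective _) (fun P i _ hP => comap_intEmbedding_ne_bot P _ hP)
    (intEmbedding_injective.comp hf) h𝔫 x hx
  rw [← Ideal.dvd_span_singleton] at hmem
  have hspan : Ideal.absNorm (Ideal.span {y}) ≠ 0 := by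
    simpa [Ideal.absNorm_eq_zero_iff, Ideal.span_singleton_eq_bot] using hy0
  have hle := Nat.le_of_dvd (Nat.pos_of_ne_zero hspan) (map_dvd Ideal.absNorm hmem)
  have hI0 := ne_zero_of_dvd_ne_zero hspan (map_dvd Ideal.absNorm hmem)
  have hlog := Real.log_le_log (Nat.cast_pos.2 (Nat.pos_of_ne_zero hI0)) (Nat.cast_le.2 hle)
  rw [map_mul] at hI0 hlog
  rw [Nat.cast_mul, Real.log_mul (Nat.cast_ne_zero.2 (left_ne_zero_of_mul hI0))
    (Nat.cast_ne_zero.2 (right_ne_zero_of_mul hI0)), log_absNorm_prod_diffIdeal hf] at hlog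
  have hmap : (Module.finrank ℚ k : ℝ) *
      Real.log (Ideal.absNorm (∏ i, 𝔫.map (intEmbedding (f i)))) =
      Fintype.card G * (m * Real.log (Ideal.absNorm 𝔫)) := by
    rw [← Real.log_pow, ← Nat.cast_pow, ← map_pow, ← Finset.prod_pow, map_prod]
    simp only [map_pow, absNorm_map_intEmbedding_pow]
    rw [Finset.prod_const, Finset.card_univ, Fintype.card_fin]
    push_cast
    rw [Real.log_pow, Real.log_pow]
    ring
  have hub : Real.log (Ideal.absNorm (Ideal.span {y})) ≤
      Fintype.card G * Real.log κ + ∑ i, ∑ g : G, Real.log (B (g • f i)) := by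
    rw [absNorm_span_singleton_eq_prod, Real.log_prod]
    · rw [Finset.sum_comm, ← nsmul_eq_mul, ← Finset.card_univ, ← Finset.sum_const,
        ← Finset.sum_add_distrib]
      refine Finset.sum_le_sum fun g _ => ?_
      rw [← Real.log_prod fun i _ => (hB _).ne', ← Real.log_mul hκ0.ne'
        (Finset.prod_ne_zero_iff.2 fun i _ => (hB _).ne')]
      refine Real.log_le_log (norm_pos_iff.2 ?_) ?_
      · simpa using hy0
      · rw [coe_det_intEmbedding]
        exact hκ _
    · intro g _
      simpa using hy0
  have hsum : (Module.finrank ℚ k : ℝ) * ∑ i, ∑ g : G, Real.log (B (g • f i)) =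
      Fintype.card G * (m * ∑ σ, Real.log (B σ)) := by
    rw [Finset.mul_sum, Finset.sum_congr rfl fun i _ =>
      card_mul_sum_smul (fun σ => Real.log (B σ)) (f i)]
    simp
    ring
  have h5 := mul_le_mul_of_nonneg_left (hlog.trans hub) hd.le
  rw [mul_add, mul_add, hmap, hsum] at h5
  refine le_of_mul_le_mul_left ?_ hG
  linarith

end IdealBox

/-! ### Lattice points in a parallelepiped of maximal volume -/

/-- A finite set of integer vectors of full rank has at most `3 ^ n * |det x|` elements, where the
rows of `x` are chosen in the set with `|det x|` maximal: by Cramer's rule the set then lies in the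
parallelepiped with coefficients in `[-1, 1]`, and the rows of `x` span a sublattice of index
`|det x|`. -/
theorem exists_det_card_le {ι : Type*} [Fintype ι] [DecidableEq ι] (F : Finset (ι → ℤ))
    (hF : ∃ x : Matrix ι ι ℤ, (∀ i, x i ∈ F) ∧ x.det ≠ 0) :
    ∃ x : Matrix ι ι ℤ, (∀ i, x i ∈ F) ∧ F.card ≤ 3 ^ Fintype.card ι * x.det.natAbs := by
  obtain ⟨x₀, hx₀F, hx₀⟩ := hF
  obtain ⟨x', hxF, hmax⟩ := Finset.exists_max_image (Fintype.piFinset fun _ : ι => F)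
    (fun x => (Matrix.of x).det.natAbs) ⟨x₀, Fintype.mem_piFinset.2 hx₀F⟩
  rw [Fintype.mem_piFinset] at hxF
  refine ⟨Matrix.of x', hxF, ?_⟩
  set x : Matrix ι ι ℤ := Matrix.of x'
  have hD : x.det ≠ 0 := by
    have h1 : x₀.det.natAbs ≤ x.det.natAbs := hmax x₀ (Fintype.mem_piFinset.2 hx₀F)
    have h0 := Int.natAbs_ne_zero.2 hx₀
    exact Int.natAbs_ne_zero.1 (by omega)
  set D := x.det with hDdef
  -- Cramer's rule: `c y i / D` is the coefficient of `x i` in `y`, and maximality bounds it by `1`.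
  let c : (ι → ℤ) → ι → ℤ := fun y i => (x.updateRow i y).det
  have hc : ∀ y ∈ F, ∀ i, (c y i).natAbs ≤ D.natAbs := by
    intro y hy i
    refine hmax (x.updateRow i y) (Fintype.mem_piFinset.2 fun j => ?_)
    rcases eq_or_ne j i with rfl | hj
    · rwa [Matrix.updateRow_self]
    · rw [Matrix.updateRow_ne hj]; exact hxF j
  have hcram : ∀ y, Matrix.vecMul (c y) x = D • y := by
    intro y
    have := Matrix.mulVec_cramer x.transpose y
    rw [Matrix.mulVec_transpose, Matrix.det_transpose] at this
    rw [← this]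
    congr 1
    ext i
    rw [Matrix.cramer_transpose_apply]
  have hli : LinearIndependent ℤ x := Matrix.linearIndependent_rows_of_det_ne_zero hD
  let N : Submodule ℤ (ι → ℤ) := Submodule.span ℤ (Set.range x)
  have hcard : Nat.card ((ι → ℤ) ⧸ N) = D.natAbs := by
    rw [← Submodule.natAbs_det_basis_change (Pi.basisFun ℤ ι) N (Module.Basis.span hli),
      Pi.basisFun_det]
    congr 2
    ext i j
    exact congrFun (congrArg Subtype.val (Module.Basis.span_apply hli i)) j
  have : Finite ((ι → ℤ) ⧸ N) := Nat.finite_of_card_ne_zero (by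
    rw [hcard]; exact Int.natAbs_ne_zero.2 hD)
  have hdiv : ∀ y ∈ F, ∀ i, c y i / D ∈ Finset.Icc (-1 : ℤ) 1 := by
    intro y hy i
    have h1 := hc y hy i
    have h2 : |c y i| ≤ |D| := by rw [Int.abs_eq_natAbs, Int.abs_eq_natAbs]; exact_mod_cast h1
    rw [Finset.mem_Icc]
    rcases lt_or_gt_of_ne hD with h | h
    · rw [abs_of_neg h, abs_le] at h2
      rw [← neg_neg D, Int.ediv_neg]
      have h3 : c y i / -D ≤ 1 := Int.ediv_le_of_le_mul (by omega) (by omega)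
      have h4 : -1 ≤ c y i / -D := (Int.le_ediv_iff_mul_le (by omega)).2 (by omega)
      omega
    · rw [abs_of_pos h, abs_le] at h2
      exact ⟨(Int.le_ediv_iff_mul_le h).2 (by omega), Int.ediv_le_of_le_mul h (by omega)⟩
  -- A point is determined by its class modulo `N` and the integral parts of its coefficients.
  let φ : F → ((ι → ℤ) ⧸ N) × (ι → Finset.Icc (-1 : ℤ) 1) := fun y =>
    (N.mkQ y, fun i => ⟨c y i / D, hdiv y y.2 i⟩)
  have hφ : Function.Injective φ := by
    rintro ⟨y, hy⟩ ⟨y', hy'⟩ h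
    obtain ⟨h1, h2⟩ := Prod.ext_iff.1 h
    have h1' : y - y' ∈ N := (Submodule.Quotient.eq N).1 h1
    obtain ⟨n, hn⟩ := (Submodule.mem_span_range_iff_exists_fun ℤ).1 h1'
    have h3 : ∀ i, c y i - c y' i = D * n i := by
      intro i
      have h4 : Matrix.vecMul (c y - c y' - D • n) x = 0 := by
        have h5 : Matrix.vecMul n x = y - y' := by
          rw [← hn]; ext j; simp [Matrix.vecMul, dotProduct]
        rw [Matrix.sub_vecMul, Matrix.sub_vecMul, Matrix.smul_vecMul, hcram, hcram, h5,
          smul_sub, sub_self]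
      have h6 := congrFun (Matrix.eq_zero_of_vecMul_eq_zero hD h4) i
      simp only [Pi.sub_apply, Pi.smul_apply, smul_eq_mul, Pi.zero_apply] at h6
      omega
    have h7 : ∀ i, n i = 0 := by
      intro i
      have h8 : c y i / D = c y' i / D := congrArg Subtype.val (congrFun h2 i)
      have h9 : c y i = c y' i + n i * D := by linarith [h3 i]
      rw [h9, Int.add_mul_ediv_right _ _ hD] at h8
      omega
    ext1
    have : ∑ i, n i • x i = 0 := Finset.sum_eq_zero fun i _ => by rw [h7 i, zero_smul]
    exact sub_eq_zero.1 (hn.symm.trans this)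
  have := Nat.card_le_card_of_injective φ hφ
  have h3 : Nat.card (Finset.Icc (-1 : ℤ) 1) = 3 := by
    rw [Nat.card_eq_fintype_card, Fintype.card_coe]; rfl
  rw [Nat.card_prod, hcard, Nat.card_eq_fintype_card, Fintype.card_coe, Nat.card_pi,
    Finset.prod_const, h3, Finset.card_univ, mul_comm] at this
  exact this

/-- A finite set `S` spanning an `r`-dimensional space has at most `3 ^ r * |det A|` elements,
where `A` expresses suitable elements of `S` in a basis of the lattice generated by `S`. -/
theorem exists_lattice_basis_card_le {V : Type*} [AddCommGroup V] [Module ℚ V]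
    (S : Finset V) {r : ℕ} (hr : Module.finrank ℚ (Submodule.span ℚ (S : Set V)) = r) :
    ∃ (z : Fin r → V) (A : Matrix (Fin r) (Fin r) ℤ),
      (∀ j, z j ∈ Submodule.span ℤ (S : Set V)) ∧ LinearIndependent ℚ z ∧
      (∀ j, ∑ l, A j l • z l ∈ S) ∧ S.card ≤ 3 ^ r * A.det.natAbs := by
  classical
  have : Module.IsTorsionFree ℤ V := Module.IsTorsionFree.trans_faithfulSMul ℤ ℚ V
  set Λ := Submodule.span ℤ (S : Set V)
  have : Module.Finite ℤ Λ := Module.Finite.span_finset ℤ S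
  have hΛV : ∀ v ∈ Λ, v ∈ Submodule.span ℚ (S : Set V) := fun v hv =>
    Submodule.span_le_restrictScalars ℤ ℚ (S : Set V) hv
  obtain ⟨b, hbS, -, hbli⟩ := Submodule.exists_fun_fin_finrank_span_eq ℚ (S : Set V)
  have hli : ∀ {n : ℕ} (w : Fin n → Λ), LinearIndependent ℤ w ↔
      LinearIndependent ℚ (fun i => (w i : V)) := by
    intro n w
    rw [← LinearIndependent.iff_fractionRing ℤ ℚ]
    exact (LinearMap.linearIndependent_iff Λ.subtype (by simp)).symm
  have hrank : Module.finrank ℤ Λ = r := by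
    rw [← hr]
    apply le_antisymm
    · have h1 := (hli (Module.finBasis ℤ Λ)).1 (Module.finBasis ℤ Λ).linearIndependent
      have : FiniteDimensional ℚ (Submodule.span ℚ (S : Set V)) :=
        FiniteDimensional.span_finset ℚ S
      have h2 : LinearIndependent ℚ (fun i => (⟨Module.finBasis ℤ Λ i,
          hΛV _ (Module.finBasis ℤ Λ i).2⟩ : Submodule.span ℚ (S : Set V))) :=
        LinearIndependent.of_comp (Submodule.subtype _) h1
      simpa using h2.fintype_card_le_finrank
    · have h1 := (hli fun i => ⟨b i, Submodule.subset_span (hbS i)⟩).2 hbli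
      simpa using h1.fintype_card_le_finrank
  let z := Module.finBasisOfFinrankEq ℤ Λ hrank
  -- Coordinates in the basis `z`, with the value `0` outside the lattice.
  let co : V → Fin r → ℤ := fun v => if h : v ∈ Λ then z.repr ⟨v, h⟩ else 0
  have hco : ∀ v ∈ S, ∑ l, co v l • (z l : V) = v := by
    intro v hv
    have h : v ∈ Λ := Submodule.subset_span hv
    have := congrArg Subtype.val (z.sum_repr ⟨v, h⟩)
    simp only [co, dif_pos h]
    simpa only [AddSubmonoidClass.coe_finsetSum, SetLike.val_smul] using this
  have hcoinj : Set.InjOn co S := by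
    intro v hv w hw h
    rw [← hco v hv, ← hco w hw, h]
  subst hr
  obtain ⟨x, hxF, hcard⟩ := exists_det_card_le (S.image co) (by
    refine ⟨Matrix.of fun i => co (b i), fun i => Finset.mem_image_of_mem _ (hbS i), fun h0 => ?_⟩
    obtain ⟨v, hv0, hv⟩ := Matrix.exists_vecMul_eq_zero_iff.2 h0
    have h1 := Fintype.linearIndependent_iff.1
      ((hli fun i => ⟨b i, Submodule.subset_span (hbS i)⟩).2 hbli) v (Subtype.ext ?_)
    · exact hv0 (funext h1)
    · simp only [AddSubmonoidClass.coe_finsetSum, SetLike.val_smul, ZeroMemClass.coe_zero]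
      calc ∑ i, v i • b i = ∑ i, v i • ∑ l, co (b i) l • (z l : V) :=
            Finset.sum_congr rfl fun i _ => by rw [hco _ (hbS i)]
        _ = ∑ l, (∑ i, v i * co (b i) l) • (z l : V) := by
            simp only [Finset.smul_sum, Finset.sum_smul, smul_smul]
            exact Finset.sum_comm
        _ = 0 := Finset.sum_eq_zero fun l _ => by
            rw [show ∑ i, v i * co (b i) l = 0 from congrFun hv l, zero_smul])
  rw [Finset.card_image_of_injOn hcoinj, Fintype.card_fin] at hcard
  refine ⟨fun l => z l, x, fun j => (z j).2, (hli z).1 z.linearIndependent, fun j => ?_, hcard⟩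
  obtain ⟨v, hv, hvx⟩ := Finset.mem_image.1 (hxF j)
  rw [← hvx, hco v hv]
  exact hv

/-! ### Elements of an ideal in a box -/

namespace IdealBox

/-- The elements of an ideal whose conjugates are bounded by `B`. -/
def idealBox {k : Type*} [Field k] (𝔫 : Ideal (𝓞 k)) (B : (k →+* ℂ) → ℝ) : Set k :=
  {x | ∃ a ∈ 𝔫, (a : k) = x ∧ ∀ σ : k →+* ℂ, ‖σ x‖ ≤ B σ}

theorem idealLattice_inter_minkowskiBox {k : Type*} [Field k] (𝔫 : Ideal (𝓞 k))
    (B : (k →+* ℂ) → ℝ) :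
    idealLattice k 𝔫 ∩ minkowskiBox k B = canonicalEmbedding k '' idealBox 𝔫 B := by
  ext v
  constructor
  · rintro ⟨⟨a, ha, rfl⟩, hv⟩
    exact ⟨a, ⟨a, ha, rfl, fun σ => (hv σ).2⟩, rfl⟩
  · rintro ⟨_, ⟨a, ha, rfl, hB⟩, rfl⟩
    refine ⟨⟨a, ha, rfl⟩, fun σ => ⟨?_, hB σ⟩⟩
    simp [canonicalEmbedding.apply_at]

variable {k : Type*} [Field k] [NumberField k]

/-- The embeddings form a basis of the `ℚ`-linear maps `k → ℂ`, so the rows `(σ (z j))_j` of a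
`ℚ`-linearly independent family span, and `r` of them are linearly independent. -/
theorem exists_det_embeddings_ne_zero {r : ℕ} {z : Fin r → k} (hz : LinearIndependent ℚ z) :
    ∃ f : Fin r → k →+* ℂ, Function.Injective f ∧ (Matrix.of fun i j => f i (z j)).det ≠ 0 := by
  have hspan : Submodule.span ℂ
      (Set.range (AlgHom.toLinearMap : (k →ₐ[ℚ] ℂ) → k →ₗ[ℚ] ℂ)) = ⊤ := by
    refine (linearIndependent_toLinearMap ℚ k ℂ).span_eq_top_of_card_eq_finrank' ?_
    rw [Module.finrank_linearMap_self, AlgHom.card]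
  let ev : (k →ₗ[ℚ] ℂ) →ₗ[ℂ] (Fin r → ℂ) :=
    { toFun := fun φ j => φ (z j)
      map_add' := fun _ _ => rfl
      map_smul' := fun _ _ => rfl }
  have hev : Function.Surjective ev := by
    obtain ⟨p, hp⟩ := LinearMap.exists_leftInverse_of_injective (Fintype.linearCombination ℚ z)
      (LinearMap.ker_eq_bot.2
        (linearIndependent_iff_injective_fintypeLinearCombination.1 hz))
    intro c
    refine ⟨(Fintype.linearCombination ℚ c).comp p, ?_⟩
    ext j
    have h1 : p (z j) = Pi.single j 1 := by
      have h2 := LinearMap.congr_fun hp (Pi.single j 1)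
      simpa [Fintype.linearCombination_apply_single] using h2
    change Fintype.linearCombination ℚ c (p (z j)) = c j
    rw [h1, Fintype.linearCombination_apply_single, one_smul]
  have htop : Submodule.span ℂ (Set.range fun (σ : k →+* ℂ) (j : Fin r) => σ (z j)) = ⊤ := by
    have h1 := congrArg (Submodule.map ev) hspan
    rw [Submodule.map_span, Submodule.map_top, LinearMap.range_eq_top.2 hev,
      ← Set.range_comp] at h1
    rw [← h1]
    congr 1
    rw [← (RingHom.equivRatAlgHom k ℂ).surjective.range_comp]
    rfl
  obtain ⟨b, hb, -, hbli⟩ := Submodule.exists_fun_fin_finrank_span_eq ℂ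
    (Set.range fun (σ : k →+* ℂ) (j : Fin r) => σ (z j))
  have hr : Module.finrank ℂ
      (Submodule.span ℂ (Set.range fun (σ : k →+* ℂ) (j : Fin r) => σ (z j))) = r := by
    rw [htop, finrank_top, Module.finrank_fin_fun]
  choose f hf using hb
  refine ⟨f ∘ Fin.cast hr.symm, ?_, ?_⟩
  · refine Function.Injective.comp (fun i i' h => hbli.injective ?_) (Fin.cast_injective _)
    rw [← hf, ← hf, h]
  · rw [← isUnit_iff_ne_zero, ← Matrix.isUnit_iff_isUnit_det,
      ← Matrix.linearIndependent_rows_iff_isUnit]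
    have h2 := hbli.comp _ (Fin.cast_injective hr.symm)
    have h3 : (Matrix.of fun i j => (f ∘ Fin.cast hr.symm) i (z j)).row =
        b ∘ Fin.cast hr.symm := by
      ext i j
      exact congrFun (hf (Fin.cast hr.symm i)) j
    rw [h3]
    exact h2

/-- Over `ℝ` as over `ℚ`: a nonvanishing minor detects independence over any subfield of `ℂ`. -/
theorem linearIndependent_canonicalEmbedding_iff {r : ℕ} (u : Fin r → k) :
    LinearIndependent ℝ (fun i => canonicalEmbedding k (u i)) ↔ LinearIndependent ℚ u := by
  constructor
  · intro h
    have h1 : LinearIndependent ℚ (fun i => canonicalEmbedding k (u i)) :=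
      h.restrict_scalars' ℚ
    exact LinearIndependent.of_comp (canonicalEmbedding k).toRatAlgHom.toLinearMap h1
  · intro h
    obtain ⟨f, -, hf⟩ := exists_det_embeddings_ne_zero h
    rw [Fintype.linearIndependent_iff]
    intro c hc i
    have h1 := Matrix.eq_zero_of_mulVec_eq_zero hf (v := fun j => (c j : ℂ)) (by
      ext i
      have := congrFun hc (f i)
      simp only [Finset.sum_apply, Pi.smul_apply, canonicalEmbedding.apply_at,
        Pi.zero_apply, Complex.real_smul] at this
      simpa [Matrix.mulVec, dotProduct, mul_comm] using this)
    exact Complex.ofReal_eq_zero.1 (congrFun h1 i)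

theorem idealBox_finite (𝔫 : Ideal (𝓞 k)) (B : (k →+* ℂ) → ℝ) : (idealBox 𝔫 B).Finite := by
  obtain ⟨b, hb⟩ := (Set.finite_range B).bddAbove
  refine (Embeddings.finite_of_norm_le k ℂ b).subset ?_
  rintro _ ⟨a, -, rfl, ha⟩
  exact ⟨RingOfIntegers.isIntegral_coe a, fun σ => (ha σ).trans (hb ⟨σ, rfl⟩)⟩

theorem norm_det_le_factorial_mul_prod {ι : Type*} [Fintype ι] [DecidableEq ι]
    {M : Matrix ι ι ℂ} {b : ι → ℝ} (h : ∀ i j, ‖M i j‖ ≤ b i) :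
    ‖M.det‖ ≤ (Fintype.card ι).factorial * ∏ i, b i := by
  rw [← Matrix.det_transpose, Matrix.det_apply]
  refine (norm_sum_le _ _).trans ?_
  rw [← Fintype.card_perm, ← nsmul_eq_mul, ← Finset.card_univ, ← Finset.sum_const]
  refine Finset.sum_le_sum fun σ _ => ?_
  have h1 : ‖Equiv.Perm.sign σ • ∏ i, M.transpose (σ i) i‖ = ‖∏ i, M.transpose (σ i) i‖ := by
    rcases Int.units_eq_one_or (Equiv.Perm.sign σ) with h | h <;> simp [h]
  rw [h1, norm_prod]
  exact Finset.prod_le_prod (fun i _ => norm_nonneg _) fun i _ => h i (σ i)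

/-- A linearly independent family in `𝔫` all of whose minors are small in terms of the number of
elements in the box. -/
theorem exists_family_of_idealBox (𝔫 : Ideal (𝓞 k)) {B : (k →+* ℂ) → ℝ} (hB : ∀ σ, 0 < B σ)
    {m : ℕ} (hm : Module.finrank ℚ (Submodule.span ℚ (idealBox 𝔫 B)) = m) :
    ∃ z : Fin m → 𝓞 k, (∀ j, z j ∈ 𝔫) ∧ LinearIndependent ℚ (fun j => (z j : k)) ∧
      ∀ h : Fin m → k →+* ℂ, ‖(Matrix.of fun i j => h i (z j)).det‖ ≤
        (m.factorial * 3 ^ m / (idealBox 𝔫 B).ncard) * ∏ i, B (h i) := by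
  have hfin := idealBox_finite 𝔫 B
  rw [← hfin.coe_toFinset] at hm
  obtain ⟨z, A, hz, hzli, hx, hcard⟩ := exists_lattice_basis_card_le hfin.toFinset hm
  have hz𝔫 : ∀ v ∈ Submodule.span ℤ (idealBox 𝔫 B), ∃ a ∈ 𝔫, (a : k) = v := by
    intro v hv
    induction hv using Submodule.span_induction with
    | mem v hv => obtain ⟨a, ha, h, -⟩ := hv; exact ⟨a, ha, h⟩
    | zero => exact ⟨0, 𝔫.zero_mem, map_zero _⟩
    | add v w _ _ hv hw =>
      obtain ⟨a, ha, rfl⟩ := hv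
      obtain ⟨b, hb, rfl⟩ := hw
      exact ⟨a + b, 𝔫.add_mem ha hb, map_add _ _ _⟩
    | smul n v _ hv =>
      obtain ⟨a, ha, rfl⟩ := hv
      exact ⟨n • a, 𝔫.smul_of_tower_mem n ha, map_zsmul _ _ _⟩
  choose a ha𝔫 ha using fun j => hz𝔫 (z j) (by simpa using hz j)
  have hpos : 0 < (idealBox 𝔫 B).ncard := by
    rw [Set.ncard_pos hfin]
    exact ⟨0, 0, 𝔫.zero_mem, map_zero _, fun σ => by simpa using (hB σ).le⟩
  refine ⟨a, ha𝔫, by simpa only [ha] using hzli, fun h => ?_⟩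
  rw [← Set.ncard_eq_toFinset_card _ hfin] at hcard
  have hx' : ∀ i j, ‖(Matrix.of fun i j => h i (∑ l, A j l • z l)) i j‖ ≤ B (h i) := by
    intro i j
    obtain ⟨-, -, -, hb⟩ := hfin.mem_toFinset.1 (hx j)
    exact hb (h i)
  -- The vectors `∑ l, A j l • z l` lie in the box, and their minors are `det A` times those of `z`.
  have hdet := norm_det_le_factorial_mul_prod hx'
  have hmul : (Matrix.of fun i j => h i (∑ l, A j l • z l)) =
      (Matrix.of fun i j => h i (a j)) * (A.map (Int.cast : ℤ → ℂ)).transpose := by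
    ext i j
    simp [Matrix.mul_apply, ha, mul_comm]
  have hAdet : (A.map (Int.cast : ℤ → ℂ)).det = (A.det : ℂ) := (Int.cast_det A).symm
  rw [hmul, Matrix.det_mul, Matrix.det_transpose, hAdet, norm_mul, Fintype.card_fin,
    Complex.norm_intCast] at hdet
  have hcard' : ((idealBox 𝔫 B).ncard : ℝ) ≤ 3 ^ m * |(A.det : ℝ)| := by
    have : ((idealBox 𝔫 B).ncard : ℝ) ≤ ((3 ^ m * A.det.natAbs : ℕ) : ℝ) := Nat.cast_le.2 hcard
    rwa [Nat.cast_mul, Nat.cast_pow, Nat.cast_ofNat, Nat.cast_natAbs, Int.cast_abs] at this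
  have hpos' : (0 : ℝ) < (idealBox 𝔫 B).ncard := Nat.cast_pos.2 hpos
  rw [div_mul_eq_mul_div, le_div_iff₀ hpos']
  calc _ ≤ ‖(Matrix.of fun i j => h i (a j)).det‖ * (3 ^ m * |(A.det : ℝ)|) := by gcongr
    _ = 3 ^ m * (‖(Matrix.of fun i j => h i (a j)).det‖ * |(A.det : ℝ)|) := by ring
    _ ≤ 3 ^ m * (m.factorial * ∏ i, B (h i)) := by gcongr
    _ = _ := by ring

/-- The maximal number of `ℝ`-linearly independent vectors in the box is the dimension of the
`ℚ`-span of the corresponding elements of `k`. -/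
theorem finrank_span_idealBox_of_isGreatest {𝔫 : Ideal (𝓞 k)} {B : (k →+* ℂ) → ℝ} {m : ℕ}
    (hm : IsGreatest {r : ℕ | ∃ v : Fin r → ((k →+* ℂ) → ℂ), LinearIndependent ℝ v ∧
      ∀ i, v i ∈ idealLattice k 𝔫 ∩ minkowskiBox k B} m) :
    Module.finrank ℚ (Submodule.span ℚ (idealBox 𝔫 B)) = m := by
  rw [idealLattice_inter_minkowskiBox] at hm
  obtain ⟨⟨v, hv, hvmem⟩, hmax⟩ := hm
  apply le_antisymm
  · obtain ⟨b, hb, -, hbli⟩ := Submodule.exists_fun_fin_finrank_span_eq ℚ (idealBox 𝔫 B)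
    exact hmax ⟨_, (linearIndependent_canonicalEmbedding_iff b).2 hbli,
      fun i => Set.mem_image_of_mem _ (hb i)⟩
  · choose u hu huv using hvmem
    obtain rfl : (fun i => canonicalEmbedding k (u i)) = v := funext huv
    have h1 := (linearIndependent_canonicalEmbedding_iff u).1 hv
    have h2 : LinearIndependent ℚ
        (fun i => (⟨u i, Submodule.subset_span (hu i)⟩ : Submodule.span ℚ (idealBox 𝔫 B))) :=
      LinearIndependent.of_comp (Submodule.subtype _) h1
    simpa using h2.fintype_card_le_finrank

end IdealBox

/-! ### Counting by volume -/

open MeasureTheory in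
open scoped Pointwise in
/-- Blichfeldt's principle with multiplicity: if every point is covered at most `n` times by the
translates of `s`, then `s` has volume at most `n` times the covolume. -/
theorem MeasureTheory.IsAddFundamentalDomain.measure_le_nat_mul {E L : Type*} [MeasurableSpace E]
    {μ : Measure E} {F s : Set E} [AddGroup L] [Countable L] [AddAction L E]
    [MeasurableConstVAdd L E] [VAddInvariantMeasure L E μ]
    (fund : IsAddFundamentalDomain L F μ) (hs : MeasurableSet s) {n : ℕ}
    (h : ∀ x, {l : L | x ∈ l +ᵥ s}.encard ≤ n) : μ s ≤ n * μ F := by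
  have hms : ∀ l : L, MeasurableSet (l +ᵥ s) := fun l => hs.const_vadd l
  calc μ s = ∑' l : L, μ ((l +ᵥ s) ∩ F) := fund.measure_eq_tsum s
    _ = ∑' l : L, ∫⁻ x in F, (l +ᵥ s).indicator 1 x ∂μ := by
        refine tsum_congr fun l => ?_
        rw [lintegral_indicator_one (hms l), Measure.restrict_apply (hms l)]
    _ = ∫⁻ x in F, ∑' l : L, (l +ᵥ s).indicator 1 x ∂μ :=
        (lintegral_tsum fun l => (measurable_one.indicator (hms l)).aemeasurable).symm
    _ ≤ ∫⁻ _ in F, n ∂μ := by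
        refine lintegral_mono fun x => ?_
        have h1 : ∑' l : L, (l +ᵥ s).indicator (1 : E → ENNReal) x =
            ∑' l : L, {l : L | x ∈ l +ᵥ s}.indicator (1 : L → ENNReal) l := rfl
        rw [h1, ← tsum_subtype]
        have h2 := ENNReal.tsum_set_one {l : L | x ∈ l +ᵥ s}
        have h3 : (({l : L | x ∈ l +ᵥ s}.encard : ENat) : ENNReal) ≤ ((n : ENat) : ENNReal) :=
          ENat.toENNReal_le.2 (h x)
        simpa [h2] using h3
    _ = n * μ F := by rw [setLIntegral_const]

namespace IdealBox

variable {k : Type*} [Field k] [NumberField k]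

theorem prod_infinitePlace_pow_mult {B : (k →+* ℂ) → ℝ}
    (hB : ∀ σ, B (ComplexEmbedding.conjugate σ) = B σ) :
    ∏ w : InfinitePlace k, B w.embedding ^ w.mult = ∏ σ, B σ := by
  classical
  rw [← Finset.prod_fiberwise Finset.univ InfinitePlace.mk B]
  refine Finset.prod_congr rfl fun w _ => ?_
  have h : ∀ σ ∈ ({σ | InfinitePlace.mk σ = w} : Finset (k →+* ℂ)), B σ = B w.embedding := by
    intro σ hσ
    rcases InfinitePlace.embedding_mk_eq σ with h | h <;>
    rw [(Finset.mem_filter.1 hσ).2] at h <;> rw [h]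
    rw [hB]
  rw [Finset.prod_congr rfl h, Finset.prod_const, InfinitePlace.card_filter_mk_eq]

open MeasureTheory mixedEmbedding in
open scoped Classical NNReal ENNReal Pointwise in
/-- The number of elements of `𝔫` in the box is at least a constant times the volume of the box
divided by the covolume of `𝔫`. -/
theorem prod_le_ncard_idealBox {𝔫 : Ideal (𝓞 k)} (h𝔫 : 𝔫 ≠ ⊥) {B : (k →+* ℂ) → ℝ}
    (hBpos : ∀ σ, 0 < B σ) (hB : ∀ σ, B (ComplexEmbedding.conjugate σ) = B σ) :
    ∏ σ, B σ ≤ 2 ^ Module.finrank ℚ k *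
      ((idealBox 𝔫 B).ncard * Ideal.absNorm 𝔫 * √|(discr k : ℝ)|) := by
  let I : (FractionalIdeal (nonZeroDivisors (𝓞 k)) k)ˣ :=
    FractionalIdeal.mk0 k ⟨𝔫, mem_nonZeroDivisors_of_ne_zero h𝔫⟩
  -- The box is halved, so that differences of its points lie in the original box.
  let f : InfinitePlace k → ℝ≥0 := fun w => ⟨B w.embedding / 2, (half_pos (hBpos _)).le⟩
  have hf : ∀ w, (f w : ℝ) = B w.embedding / 2 := fun w => rfl
  let L := (Submodule.span ℤ (Set.range (fractionalIdealLatticeBasis k I))).toAddSubgroup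
  have fund : IsAddFundamentalDomain L
      (ZSpan.fundamentalDomain (fractionalIdealLatticeBasis k I)) volume :=
    ZSpan.isAddFundamentalDomain' (fractionalIdealLatticeBasis k I) volume
  have : Countable L := by
    change Countable (Submodule.span ℤ (Set.range (fractionalIdealLatticeBasis k I)))
    infer_instance
  have hL : ∀ l : L, ∃ a ∈ 𝔫, mixedEmbedding k (a : k) = l := by
    rintro ⟨l, hl⟩
    rw [Submodule.mem_toAddSubgroup, mem_span_fractionalIdealLatticeBasis] at hl
    obtain ⟨y, hy, rfl⟩ := hl
    obtain ⟨a, ha, rfl⟩ := (FractionalIdeal.mem_coeIdeal _).1 hy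
    exact ⟨a, ha, rfl⟩
  choose a ha hal using hL
  have hfin := idealBox_finite 𝔫 B
  have hcount : ∀ x, {l : L | x ∈ l +ᵥ convexBodyLT k f}.encard ≤ (idealBox 𝔫 B).ncard := by
    intro x
    rw [hfin.cast_ncard_eq]
    rcases Set.eq_empty_or_nonempty {l : L | x ∈ l +ᵥ convexBodyLT k f} with h0 | ⟨l₀, hl₀⟩
    · rw [h0, Set.encard_empty]; exact zero_le
    -- Subtracting a fixed `l₀` sends the translates that cover `x` injectively into the box.
    refine Set.encard_le_encard_of_injOn (f := fun l => ((a l - a l₀ : 𝓞 k) : k)) ?_ ?_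
    · intro l hl
      refine ⟨a l - a l₀, 𝔫.sub_mem (ha l) (ha l₀), rfl, fun σ => ?_⟩
      obtain ⟨y, hy, hyx⟩ := hl
      obtain ⟨y₀, hy₀, hyx₀⟩ := hl₀
      have h1 : mixedEmbedding k ((a l - a l₀ : 𝓞 k) : k) = y₀ - y := by
        rw [show ((a l - a l₀ : 𝓞 k) : k) = (a l : k) - (a l₀ : k) from map_sub _ _ _, map_sub,
          hal, hal]
        have h2 : (l : mixedSpace k) + y = l₀ + y₀ := hyx.trans hyx₀.symm
        rw [sub_eq_sub_iff_add_eq_add, h2, add_comm]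
      have h3 : y₀ - y ∈ convexBodyLT k (fun w => f w + f w) := by
        simp only [convexBodyLT, Set.mem_prod, Set.mem_pi, Set.mem_univ, mem_ball_zero_iff,
          forall_true_left] at hy hy₀ ⊢
        refine ⟨fun w => ?_, fun w => ?_⟩
        · exact (norm_sub_le _ _).trans_lt (add_lt_add (hy₀.1 w) (hy.1 w))
        · exact (norm_sub_le _ _).trans_lt (add_lt_add (hy₀.2 w) (hy.2 w))
      rw [← h1, convexBodyLT_mem] at h3
      have h4 := h3 (InfinitePlace.mk σ)
      rw [InfinitePlace.apply, NNReal.coe_add, hf, add_halves] at h4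
      have h5 : B (InfinitePlace.mk σ).embedding = B σ := by
        rcases InfinitePlace.embedding_mk_eq σ with h | h <;> rw [h]
        exact hB σ
      rw [h5] at h4
      exact h4.le
    · intro l _ l' _ h
      have h1 : a l = a l' := by
        have := RingOfIntegers.ext h
        exact sub_left_injective this
      exact Subtype.ext (by rw [← hal, ← hal, h1])
  have hmeas : MeasurableSet (convexBodyLT k f) :=
    (MeasurableSet.univ_pi fun _ => measurableSet_ball).prod
      (MeasurableSet.univ_pi fun _ => measurableSet_ball)
  have hvol := fund.measure_le_nat_mul hmeas hcount
  rw [convexBodyLT_volume, volume_fundamentalDomain_fractionalIdealLatticeBasis,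
    volume_fundamentalDomain_latticeBasis] at hvol
  have hvol' := ENNReal.toReal_mono (by finiteness) hvol
  simp only [ENNReal.toReal_mul, NNReal.coe_prod, NNReal.coe_pow, ENNReal.toReal_pow,
    ENNReal.coe_toReal, ENNReal.toReal_natCast, ENNReal.toReal_inv, ENNReal.toReal_ofNat,
    Real.coe_sqrt, coe_nnnorm, Int.norm_eq_abs, hf, div_pow, Finset.prod_div_distrib,
    Finset.prod_pow_eq_pow_sum,
    InfinitePlace.sum_mult_eq, prod_infinitePlace_pow_mult hB] at hvol'
  have hN : (ENNReal.ofReal (FractionalIdeal.absNorm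
      (I : FractionalIdeal (nonZeroDivisors (𝓞 k)) k))).toReal = Ideal.absNorm 𝔫 := by
    rw [FractionalIdeal.coe_mk0, FractionalIdeal.coeIdeal_absNorm]
    simp
  rw [hN] at hvol'
  have hfac : (1 : ℝ) ≤ convexBodyLTFactor k := by exact_mod_cast one_le_convexBodyLTFactor k
  have hpow : ((2 : ℝ)⁻¹) ^ InfinitePlace.nrComplexPlaces k ≤ 1 :=
    pow_le_one₀ (by norm_num) (by norm_num)
  have h2 : (0 : ℝ) < 2 ^ Module.finrank ℚ k := by positivity
  have hT : 0 ≤ (∏ σ, B σ) / 2 ^ Module.finrank ℚ k :=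
    div_nonneg (Finset.prod_nonneg fun σ _ => (hBpos σ).le) h2.le
  rw [← div_le_iff₀' h2]
  calc (∏ σ, B σ) / 2 ^ Module.finrank ℚ k
      ≤ convexBodyLTFactor k * ((∏ σ, B σ) / 2 ^ Module.finrank ℚ k) :=
        le_mul_of_one_le_left hT hfac
    _ ≤ _ := hvol'
    _ ≤ (idealBox 𝔫 B).ncard * (Ideal.absNorm 𝔫 * (1 * √|(discr k : ℝ)|)) := by gcongr
    _ = _ := by ring

end IdealBox

/-! ### Exponents of the discriminant -/

namespace IdealBox

variable {k : Type*} [Field k] [NumberField k]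

/-- By transitivity all rows of the matrix `logDiff` have the same sum. -/
theorem finrank_mul_sum_logDiff (σ : k →+* ℂ) :
    Module.finrank ℚ k * ∑ τ, logDiff σ τ = Real.log |(discr k : ℝ)| := by
  have hconst : ∀ ρ : k →+* ℂ, ∑ τ, logDiff ρ τ = ∑ τ, logDiff σ τ := by
    intro ρ
    obtain ⟨g, rfl⟩ := exists_smul_eq σ ρ
    rw [← Equiv.sum_comp (MulAction.toPerm g)]
    exact Finset.sum_congr rfl fun τ _ => logDiff_smul g σ τ
  rw [← sum_sum_logDiff, Finset.sum_congr rfl fun ρ _ => hconst ρ, Finset.sum_const,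
    Finset.card_univ, Embeddings.card, nsmul_eq_mul]

/-- All row sums of the matrix `logDiff` are equal. Removing the `d - m` rows and the `d - m`
columns outside the range of `f` therefore removes at most `2 (d - m) / d` of the total. -/
theorem le_sum_sum_logDiff {m : ℕ} {f : Fin m → k →+* ℂ} (hf : Function.Injective f) :
    (2 * m - Module.finrank ℚ k) * Real.log |(discr k : ℝ)| ≤
      Module.finrank ℚ k * ∑ i, ∑ j, logDiff (f i) (f j) := by
  classical
  set d : ℝ := (Module.finrank ℚ k : ℝ)
  set S : Finset (k →+* ℂ) := Finset.univ.image f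
  have hS : S.card = m := by
    rw [Finset.card_image_of_injective _ hf, Finset.card_univ, Fintype.card_fin]
  have hSc : (Sᶜ.card : ℝ) = d - m := by
    rw [Finset.card_compl, Nat.cast_sub (Finset.card_le_univ _), Embeddings.card, hS]
  have hsum : ∑ i, ∑ j, logDiff (f i) (f j) = ∑ σ ∈ S, ∑ τ ∈ S, logDiff σ τ := by
    rw [Finset.sum_image hf.injOn]
    exact Finset.sum_congr rfl fun i _ => (Finset.sum_image (f := logDiff (f i)) hf.injOn).symm
  have hcompl : ∑ σ ∈ S, ∑ τ ∈ Sᶜ, logDiff σ τ ≤ ∑ τ ∈ Sᶜ, ∑ σ, logDiff τ σ := by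
    rw [Finset.sum_comm]
    refine Finset.sum_le_sum fun τ _ => ?_
    simp only [logDiff_comm _ τ]
    exact Finset.sum_le_sum_of_subset_of_nonneg (Finset.subset_univ _)
      fun σ _ _ => logDiff_nonneg τ σ
  have hrow : ∀ T : Finset (k →+* ℂ), d * ∑ σ ∈ T, ∑ τ, logDiff σ τ =
      T.card * Real.log |(discr k : ℝ)| := by
    intro T
    rw [Finset.mul_sum, Finset.sum_congr rfl fun σ _ => finrank_mul_sum_logDiff σ,
      Finset.sum_const, nsmul_eq_mul]
  have hsplit : ∑ σ ∈ S, ∑ τ, logDiff σ τ =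
      ∑ σ ∈ S, ∑ τ ∈ S, logDiff σ τ + ∑ σ ∈ S, ∑ τ ∈ Sᶜ, logDiff σ τ := by
    rw [← Finset.sum_add_distrib]
    exact Finset.sum_congr rfl fun σ _ => (Finset.sum_add_sum_compl S _).symm
  have h1 := hrow S
  have h2 := hrow Sᶜ
  have h3 := mul_le_mul_of_nonneg_left hcompl (Nat.cast_nonneg _ : 0 ≤ d)
  rw [hS, hsplit] at h1
  rw [hSc] at h2
  rw [hsum]
  linarith

/-- A Galois element carrying `{σ, τ}` to `{σ', τ'}` may exchange the two entries, which is harmless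
because `logDiff` is symmetric. -/
theorem IsTwoHomogeneous.logDiff_eq (hG : IsTwoHomogeneous k) {σ τ σ' τ' : k →+* ℂ}
    (h : σ ≠ τ) (h' : σ' ≠ τ') : logDiff σ τ = logDiff σ' τ' := by
  classical
  unfold IsTwoHomogeneous at hG
  obtain ⟨g, hg⟩ := hG.exists_smul_eq
    (⟨{σ, τ}, by simpa [Set.powersetCard.mem_iff] using Finset.card_pair h⟩ :
      Set.powersetCard (k →+* ℂ) 2)
    ⟨{σ', τ'}, by simpa [Set.powersetCard.mem_iff] using Finset.card_pair h'⟩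
  have hset : ({g • σ, g • τ} : Set (k →+* ℂ)) = {σ', τ'} := by
    have h1 := congrArg (fun s : Set.powersetCard (k →+* ℂ) 2 =>
      ((s : Finset (k →+* ℂ)) : Set (k →+* ℂ))) hg
    simpa [Finset.smul_finset_insert] using h1
  rw [← logDiff_smul g σ τ]
  rcases Set.pair_eq_pair_iff.1 hset with ⟨h1, h2⟩ | ⟨h1, h2⟩
  · rw [h1, h2]
  · rw [h1, h2, logDiff_comm]

theorem IsTwoHomogeneous.sum_logDiff_eq (hG : IsTwoHomogeneous k) {σ τ : k →+* ℂ} (h : σ ≠ τ)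
    {ι : Type*} [Fintype ι] {f : ι → k →+* ℂ} (hf : Function.Injective f) (i : ι) :
    ∑ j, logDiff (f i) (f j) = (Fintype.card ι - 1) * logDiff σ τ := by
  classical
  have h1 : ∀ j, logDiff (f i) (f j) = logDiff σ τ - if i = j then logDiff σ τ else 0 := by
    intro j
    split_ifs with hij
    · rw [hij, logDiff_self, sub_self]
    · rw [sub_zero, hG.logDiff_eq (hf.ne hij) h]
  rw [Finset.sum_congr rfl fun j _ => h1 j, Finset.sum_sub_distrib]
  simp [sub_mul]

theorem IsTwoHomogeneous.sum_sum_logDiff_eq (hG : IsTwoHomogeneous k)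
    (hd : 1 < Module.finrank ℚ k) {m : ℕ} {f : Fin m → k →+* ℂ} (hf : Function.Injective f) :
    Module.finrank ℚ k * ∑ i, ∑ j, logDiff (f i) (f j) =
      m * (m - 1) / (Module.finrank ℚ k - 1) * Real.log |(discr k : ℝ)| := by
  obtain ⟨σ, τ, h⟩ : ∃ σ τ : k →+* ℂ, σ ≠ τ :=
    Fintype.exists_pair_of_one_lt_card (by rwa [Embeddings.card])
  have hd' : (Module.finrank ℚ k : ℝ) - 1 ≠ 0 :=
    sub_ne_zero.2 (Nat.one_lt_cast.2 hd).ne'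
  have hrow := hG.sum_logDiff_eq h Function.injective_id σ
  simp only [id] at hrow
  rw [← finrank_mul_sum_logDiff σ, hrow, Embeddings.card,
    Finset.sum_congr rfl fun i _ => hG.sum_logDiff_eq h hf i]
  simp
  field_simp

/-- The lower bound for the minor and the lower bound for the number of elements in the box combine
to an upper bound for that number, once the part of the discriminant in the minor is known. -/
theorem ncard_idealBox_le {𝔫 : Ideal (𝓞 k)} (h𝔫 : 𝔫 ≠ ⊥) {B : (k →+* ℂ) → ℝ}
    (hBpos : ∀ σ, 0 < B σ) (hB : ∀ σ, B (ComplexEmbedding.conjugate σ) = B σ) {m : ℕ}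
    (hm : Module.finrank ℚ (Submodule.span ℚ (idealBox 𝔫 B)) = m)
    (hmd : m < Module.finrank ℚ k) {e : ℝ}
    (he : ∀ f : Fin m → k →+* ℂ, Function.Injective f →
      (m / 2 - (Module.finrank ℚ k - m) * e) * Real.log |(discr k : ℝ)| ≤
        Module.finrank ℚ k * ((∑ i, ∑ j, logDiff (f i) (f j)) / 2)) :
    ((idealBox 𝔫 B).ncard : ℝ) ≤
      Real.exp (Module.finrank ℚ k * (Real.log ((Module.finrank ℚ k).factorial *
        3 ^ Module.finrank ℚ k) + Module.finrank ℚ k * Real.log 2)) *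
      |(discr k : ℝ)| ^ e := by
  obtain ⟨z, hz, hli, hdet⟩ := exists_family_of_idealBox 𝔫 hBpos hm
  obtain ⟨f, hf, hf0⟩ := exists_det_embeddings_ne_zero hli
  have hlow := log_absNorm_add_sum_logDiff_le h𝔫 hBpos hf hz hf0 hdet
  have hbox := prod_le_ncard_idealBox h𝔫 hBpos hB
  have he := he f hf
  set d := Module.finrank ℚ k
  set X := (idealBox 𝔫 B).ncard
  have h0 : (0 : k) ∈ idealBox 𝔫 B := ⟨0, zero_mem _, by simp, fun σ => by simp [(hBpos σ).le]⟩
  have hX : (0 : ℝ) < X := Nat.cast_pos.2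
    ((Set.ncard_pos (idealBox_finite 𝔫 B)).2 ⟨0, h0⟩)
  have hX1 : 0 ≤ Real.log X := Real.log_natCast_nonneg _
  have hN : (Ideal.absNorm 𝔫 : ℝ) ≠ 0 := by
    rwa [Nat.cast_ne_zero, Ne, Ideal.absNorm_eq_zero_iff]
  have hΔ : (0 : ℝ) < |(discr k : ℝ)| := abs_pos.2 (Int.cast_ne_zero.2 (discr_ne_zero k))
  have hbox' := Real.log_le_log (Finset.prod_pos fun σ _ => hBpos σ) hbox
  rw [Real.log_prod fun σ _ => (hBpos σ).ne', Real.log_mul (by positivity) (by positivity),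
    Real.log_mul (by positivity) (by positivity), Real.log_mul hX.ne' hN, Real.log_pow,
    Real.log_sqrt hΔ.le] at hbox'
  rw [Real.log_div (by positivity) hX.ne'] at hlow
  have hc : Real.log (m.factorial * 3 ^ m) ≤ Real.log (d.factorial * 3 ^ d) := by
    refine Real.log_le_log (by positivity) ?_
    gcongr
    · norm_num
  have hmd' : (m : ℝ) + 1 ≤ d := by exact_mod_cast hmd
  have hm0 : (0 : ℝ) ≤ m := Nat.cast_nonneg m
  have hd0 : (0 : ℝ) ≤ d := Nat.cast_nonneg d
  have hlog2 : 0 ≤ Real.log 2 := Real.log_nonneg (by norm_num)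
  have hC : 0 ≤ Real.log (d.factorial * 3 ^ d) := by
    exact_mod_cast Real.log_natCast_nonneg (d.factorial * 3 ^ d)
  set E := d * (Real.log (d.factorial * 3 ^ d) + d * Real.log 2) with hE
  have hE0 : 0 ≤ E := by positivity
  -- Eliminate `∑ log B` and `log N(𝔫)` between `hlow` and `m` times `hbox'`.
  have key : (d - m) * Real.log X ≤ (d - m) * (E + e * Real.log |(discr k : ℝ)|) := by
    have h1 := mul_le_mul_of_nonneg_left hbox' hm0
    have h2 := mul_le_mul_of_nonneg_left hc hd0
    have h3 : (m : ℝ) * (d * Real.log 2) ≤ d * (d * Real.log 2) := by gcongr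
    have h4 : E ≤ (d - m) * E := le_mul_of_one_le_left hE0 (by linarith)
    linarith
  have key' := le_of_mul_le_mul_left key (by linarith : (0 : ℝ) < d - m)
  rw [Real.rpow_def_of_pos hΔ, ← Real.exp_add, ← Real.log_le_iff_le_exp hX]
  linarith

end IdealBox

end

theorem mainTheorem1 (d : ℕ) (hd : 1 < d) :
    ∃ C : ℝ, 0 < C ∧
      ∀ (k : Type*) [Field k] [NumberField k], Module.finrank ℚ k = d →
      ∀ (𝔫 : Ideal (NumberField.RingOfIntegers k)), 𝔫 ≠ ⊥ →
      ∀ (B : (k →+* ℂ) → ℝ), (∀ σ, 0 < B σ) →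
        (∀ σ, B (NumberField.ComplexEmbedding.conjugate σ) = B σ) →
      ∀ (m : ℕ),
        IsGreatest {r : ℕ | ∃ v : Fin r → ((k →+* ℂ) → ℂ), LinearIndependent ℝ v ∧
          ∀ i, v i ∈ IdealBox.idealLattice k 𝔫 ∩ IdealBox.minkowskiBox k B} m →
        m < d →
        (IdealBox.idealLattice k 𝔫 ∩ IdealBox.minkowskiBox k B).Finite ∧
        ((IdealBox.idealLattice k 𝔫 ∩ IdealBox.minkowskiBox k B).ncard : ℝ) ≤
          C * |(NumberField.discr k : ℝ)| ^
            min (1 / 2 : ℝ) ((m : ℝ) / (2 * (d : ℝ) - 2 * (m : ℝ))) ∧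
        (IdealBox.IsTwoHomogeneous k →
          ((IdealBox.idealLattice k 𝔫 ∩ IdealBox.minkowskiBox k B).ncard : ℝ) ≤
            C * |(NumberField.discr k : ℝ)| ^ ((m : ℝ) / (2 * (d : ℝ) - 2))) := by
  refine ⟨Real.exp (d * (Real.log (d.factorial * 3 ^ d) + d * Real.log 2)), Real.exp_pos _, ?_⟩
  intro k _ _ hk 𝔫 h𝔫 B hBpos hB m hm hmd
  subst hk
  have hm' := IdealBox.finrank_span_idealBox_of_isGreatest hm
  rw [IdealBox.idealLattice_inter_minkowskiBox,
    Set.ncard_image_of_injective _ (NumberField.canonicalEmbedding_injective k)]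
  have hm1 : (m : ℝ) < Module.finrank ℚ k := by exact_mod_cast hmd
  have hd1 : (1 : ℝ) < Module.finrank ℚ k := by exact_mod_cast hd
  refine ⟨(IdealBox.idealBox_finite 𝔫 B).image _, ?_, fun hG => ?_⟩
  · refine IdealBox.ncard_idealBox_le h𝔫 hBpos hB hm' hmd fun f hf => ?_
    rcases min_choice (1 / 2 : ℝ)
      ((m : ℝ) / (2 * (Module.finrank ℚ k : ℝ) - 2 * (m : ℝ))) with h | h
    · rw [h]
      have := IdealBox.le_sum_sum_logDiff hf
      linarith
    · have h0 : (m : ℝ) / 2 - (Module.finrank ℚ k - m) *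
          (m / (2 * Module.finrank ℚ k - 2 * m)) = 0 := by
        have : (Module.finrank ℚ k : ℝ) - m ≠ 0 := by linarith
        rw [← mul_sub]
        field_simp
        ring
      rw [h, h0, zero_mul]
      exact mul_nonneg (Nat.cast_nonneg _) (div_nonneg (Finset.sum_nonneg fun i _ =>
        Finset.sum_nonneg fun j _ => IdealBox.logDiff_nonneg _ _) two_pos.le)
  · refine IdealBox.ncard_idealBox_le h𝔫 hBpos hB hm' hmd fun f hf => le_of_eq ?_
    rw [mul_div_assoc' (Module.finrank ℚ k : ℝ), hG.sum_sum_logDiff_eq hd hf]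
    have : (Module.finrank ℚ k : ℝ) - 1 ≠ 0 := by linarith
    have h2 : 2 * (Module.finrank ℚ k : ℝ) - 2 = 2 * (Module.finrank ℚ k - 1) := by ring
    rw [h2]
    field_simp
    ring
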